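/- Let $n\ge 0$ and let $H$ be the hyperbolic space of dimension $n+1$ and constant sectional curvature $-1$, with Levi-Civita connection $\nabla$. Let $\mathcal L$ be the $2n$-dimensional manifold of all complete oriented geodesics $[\gamma]$ of $H$ (unit speed geodesics $\gamma:\mathbb R\to H$ up to orientation preserving reparametrization), whose smooth structure is the one for which $F:\mathcal L\to (S^n\times S^n)\setminus\{(p,p)\mid p\in S^n\}$, $F([\gamma])=(\gamma(-\infty),\gamma(\infty))$, is a diffeomorphism; here $\gamma(\pm\infty)\in S^n$ denotes the limit of $\gamma(t)$ as $t\to\pm\infty$ in the unit ball model of $H$. The forward and backward Gauss maps $\varphi_\pm:\mathcal L\to S^n$ are given by $\varphi_\pm([\gamma])=\gamma(\pm\infty)$. Let $V$ be a smooth unit vector field on $H$ all of whose integral curves are geodesics (a smooth geodesic foliation of $H$, whose leaves are the maximal integral curves of $V$), and suppose that it is a t.e.r. geodesic foliation, that is, $|\nabla_v V|<|v|$ for every nonzero tangent vector $v$ of $H$. Let $\mathcal M\subset\mathcal L$ be the set of its leaves, each oriented by $V$. Then $\mathcal M$ is an embedded $n$-dimensional smooth submanifold of $\mathcal L$, and,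 for its submanifold structure, the restrictions $\varphi_+|_{\mathcal M}:\mathcal M\to S^n$ and $\varphi_-|_{\mathcal M}:\mathcal M\to S^n$ are (smooth) local diffeomorphisms. -/

import Mathlib

open Set Filter Topology
open scoped Manifold ContDiff

noncomputable section

/-! ### Hyperbolic space (hyperboloid model) -/

/-- Minkowski space `ℝ × ℝⁿ⁺¹`; the first coordinate is the time coordinate. -/
abbrev Mink (n : ℕ) : Type := ℝ × EuclideanSpace ℝ (Fin (n + 1))

/-- The Lorentzian bilinear form `⟨x, y⟩ = x' · y' - x₀ y₀`. -/
def lform {n : ℕ} (x y : Mink n) : ℝ := inner ℝ x.2 y.2 - x.1 * y.1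

/-- Hyperbolic space of dimension `n + 1` and curvature `-1`: the upper sheet of the hyperboloid
`⟨x, x⟩ = -1`, with the Riemannian metric given by restricting `lform` to its tangent spaces
`{v | ⟨x, v⟩ = 0}`. -/
def Hyp (n : ℕ) : Set (Mink n) := {x | lform x x = -1 ∧ 0 < x.1}

/-- `|v| = |⟨v, v⟩|^(1/2)`. -/
def lnorm {n : ℕ} (v : Mink n) : ℝ := Real.sqrt |lform v v|

/-- For `x ∈ Hyp n`, the orthogonal projection of Minkowski space onto the tangent space
`{v | ⟨x, v⟩ = 0}` of `Hyp n` at `x`. -/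
def tanProj {n : ℕ} (x w : Mink n) : Mink n := w + lform x w • x

/-- The Levi-Civita covariant derivative `∇_v V` at `x ∈ Hyp n` of a vector field `V` along
`Hyp n`, for `v` tangent to `Hyp n` at `x`: the tangential part of the ambient derivative. -/
def covDeriv {n : ℕ} (V : Mink n → Mink n) (x v : Mink n) : Mink n :=
  tanProj x (fderiv ℝ V x v)

/-- `γ` restricted to the open set `s` of times is a geodesic of `Hyp n`: a smooth curve in `Hyp n`
with `∇_{γ'} γ' = 0` (the tangential part of the ambient acceleration vanishes). -/
def IsGeodesicOn {n : ℕ} (γ : ℝ → Mink n) (s : Set ℝ) : Prop :=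
  ContDiffOn ℝ ∞ γ s ∧ ∀ t ∈ s, γ t ∈ Hyp n ∧ tanProj (γ t) (deriv (deriv γ) t) = 0

/-! ### The space of oriented geodesics -/

/-- Complete unit speed geodesics of `Hyp n`. -/
structure UnitGeodesic (n : ℕ) where
  curve : ℝ → Mink n
  geodesic : IsGeodesicOn curve univ
  unit_speed : ∀ t, lnorm (deriv curve t) = 1

/-- Two unit speed geodesics define the same oriented geodesic if they differ by an orientation
preserving (hence translational) reparametrization. -/
instance UnitGeodesic.setoid (n : ℕ) : Setoid (UnitGeodesic n) where
  r γ₁ γ₂ := ∃ a : ℝ, ∀ t, γ₁.curve t = γ₂.curve (t + a)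
  iseqv :=
    { refl := fun γ => ⟨0, fun t => by simp⟩
      symm := fun {γ₁ γ₂} ⟨a, h⟩ => ⟨-a, fun t => by rw [h]; simp⟩
      trans := fun {γ₁ γ₂ γ₃} ⟨a, h⟩ ⟨b, k⟩ => ⟨a + b, fun t => by rw [h, k, add_assoc]⟩ }

/-- The space `𝓛` of complete oriented geodesics of `Hyp n`. -/
def OrientedGeodesic (n : ℕ) : Type := Quotient (UnitGeodesic.setoid n)

/-- The sphere at infinity `Sⁿ`, the unit sphere of `ℝⁿ⁺¹`. -/
abbrev Sph (n : ℕ) : Type := Metric.sphere (0 : EuclideanSpace ℝ (Fin (n + 1))) 1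

/-- The isometry from the hyperboloid model onto the unit ball model (stereographic projection). -/
def toBall {n : ℕ} (x : Mink n) : EuclideanSpace ℝ (Fin (n + 1)) := (1 + x.1)⁻¹ • x.2

section aux

variable {n : ℕ}

lemma lform_comm (x y : Mink n) : lform x y = lform y x := by
  simp only [lform, real_inner_comm, mul_comm]

lemma lform_add_left (x y z : Mink n) : lform (x + y) z = lform x z + lform y z := by
  simp only [lform, Prod.fst_add, Prod.snd_add, inner_add_left]; ring

lemma lform_smul_left (c : ℝ) (x z : Mink n) : lform (c • x) z = c * lform x z := by
  simp only [lform, Prod.smul_fst, Prod.smul_snd, inner_smul_left, smul_eq_mul]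
  simp; ring

lemma lform_add_right (x y z : Mink n) : lform x (y + z) = lform x y + lform x z := by
  rw [lform_comm, lform_add_left, lform_comm y, lform_comm z]

lemma lform_smul_right (c : ℝ) (x z : Mink n) : lform x (c • z) = c * lform x z := by
  rw [lform_comm, lform_smul_left, lform_comm]

lemma hasDerivAt_lform {f g : ℝ → Mink n} {f' g' : Mink n} {t : ℝ}
    (hf : HasDerivAt f f' t) (hg : HasDerivAt g g' t) :
    HasDerivAt (fun s => lform (f s) (g s)) (lform (f t) g' + lform f' (g t)) t := by
  have h1 : HasDerivAt (fun s => (f s).1) f'.1 t := (hasFDerivAt_fst (p := f t)).comp_hasDerivAt t hf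
  have h2 : HasDerivAt (fun s => (f s).2) f'.2 t := (hasFDerivAt_snd (p := f t)).comp_hasDerivAt t hf
  have h3 : HasDerivAt (fun s => (g s).1) g'.1 t := (hasFDerivAt_fst (p := g t)).comp_hasDerivAt t hg
  have h4 : HasDerivAt (fun s => (g s).2) g'.2 t := (hasFDerivAt_snd (p := g t)).comp_hasDerivAt t hg
  have := (h2.inner ℝ h4).sub (h1.mul h3)
  refine this.congr_deriv ?_
  simp only [lform]; ring

/-- A null vector has `|x'| = |x₀|`. -/
lemma norm_snd_of_null {u : Mink n} (h : lform u u = 0) : ‖u.2‖ = |u.1| := by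
  have : ‖u.2‖ ^ 2 = |u.1| ^ 2 := by
    rw [sq_abs, ← real_inner_self_eq_norm_sq]; simp only [lform] at h; linarith
  exact (pow_left_inj₀ (norm_nonneg _) (abs_nonneg _) two_ne_zero).1 this

lemma fst_pos_of_null {u w : Mink n} (hu : lform u u = 0) (hw : lform w w = 0)
    (huw : lform u w = -2) (hpos : 0 < u.1 + w.1) : 0 < u.1 := by
  by_contra hcon
  push Not at hcon
  have hw1 : 0 < w.1 := by linarith
  have h1 := norm_snd_of_null hu
  have h2 := norm_snd_of_null hw
  have h3 := abs_real_inner_le_norm u.2 w.2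
  rw [h1, h2, abs_of_nonpos hcon, abs_of_pos hw1] at h3
  have h4 := (abs_le.1 h3).1
  simp only [lform] at huw
  linarith

/-- Explicit form of the unit speed geodesics. -/
lemma UnitGeodesic.exists_eq (γ : UnitGeodesic n) : ∃ u w : Mink n,
    lform u u = 0 ∧ lform w w = 0 ∧ lform u w = -2 ∧ 0 < u.1 ∧ 0 < w.1 ∧
    ∀ t, γ.curve t = (Real.exp t / 2) • u + (Real.exp (-t) / 2) • w := by
  obtain ⟨c, ⟨hs, hg⟩, hu⟩ := γ
  have hs' : ContDiff ℝ ∞ c := contDiffOn_univ.1 hs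
  have hd1 : ∀ t, HasDerivAt c (deriv c t) t := fun t =>
    (hs'.differentiable (by simp) t).hasDerivAt
  have hs2 : ContDiff ℝ ∞ (deriv c) := (contDiff_infty_iff_deriv.1 hs').2
  have hd2 : ∀ t, HasDerivAt (deriv c) (deriv (deriv c) t) t := fun t =>
    (hs2.differentiable (by simp) t).hasDerivAt
  have e0 : ∀ t, lform (c t) (c t) = -1 := fun t => (hg t (mem_univ t)).1.1
  have e1 : ∀ t, lform (c t) (deriv c t) = 0 := fun t => by
    have h := (hasDerivAt_lform (hd1 t) (hd1 t)).unique
      ((hasDerivAt_const t (-1 : ℝ)).congr_of_eventuallyEq (Eventually.of_forall e0))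
    rw [lform_comm (deriv c t)] at h; linarith
  have e2 : ∀ t, lform (c t) (deriv (deriv c) t) + lform (deriv c t) (deriv c t) = 0 := fun t =>
    (hasDerivAt_lform (hd1 t) (hd2 t)).unique
      ((hasDerivAt_const t (0 : ℝ)).congr_of_eventuallyEq (Eventually.of_forall e1))
  have ed : ∀ t, deriv (deriv c) t = lform (deriv c t) (deriv c t) • c t := fun t => by
    have h := (hg t (mem_univ t)).2
    have h2 : lform (c t) (deriv (deriv c) t) = - lform (deriv c t) (deriv c t) := by
      linarith [e2 t]
    rw [tanProj, h2, neg_smul, ← sub_eq_add_neg, sub_eq_zero] at h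
    exact h
  -- the squared speed is constant, and it is `1` since tangent vectors are space-like
  have e3 : ∀ t, lform (deriv c t) (deriv c t) = 1 := by
    intro t
    have habs : |lform (deriv c t) (deriv c t)| = 1 := by
      have h := hu t
      simp only [lnorm] at h
      rwa [Real.sqrt_eq_one] at h
    have hnn : 0 ≤ lform (deriv c t) (deriv c t) := by
      have hp := (hg t (mem_univ t)).1.2
      have a0 := e0 t
      have a1 := e1 t
      have cs := real_inner_mul_inner_self_le (c t).2 (deriv c t).2
      simp only [lform] at a0 a1 ⊢
      set A := inner ℝ (c t).2 (c t).2
      set B := inner ℝ (c t).2 (deriv c t).2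
      set D := inner ℝ (deriv c t).2 (deriv c t).2
      have hD : 0 ≤ D := real_inner_self_nonneg
      have hA : A = (c t).1 * (c t).1 - 1 := by linarith
      have hB : B = (c t).1 * (deriv c t).1 := by linarith
      rw [hA, hB] at cs
      have : 0 ≤ ((c t).1 * (c t).1) * (D - (deriv c t).1 * (deriv c t).1) := by nlinarith
      exact nonneg_of_mul_nonneg_right this (mul_pos hp hp)
    rwa [abs_of_nonneg hnn] at habs
  have ed' : ∀ t, HasDerivAt (deriv c) (c t) t := fun t => by
    have := hd2 t; rwa [ed t, e3 t, one_smul] at this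
  have hU : ∀ t, Real.exp (-t) • (c t + deriv c t) = c 0 + deriv c 0 := by
    have hder : ∀ t, HasDerivAt (fun t => Real.exp (-t) • (c t + deriv c t)) 0 t := fun t => by
      have h1 : HasDerivAt (fun t => Real.exp (-t)) (Real.exp (-t) * (-1)) t :=
        (hasDerivAt_neg t).exp
      refine (h1.smul ((hd1 t).add (ed' t))).congr_deriv ?_
      simp only [Pi.add_apply]
      module
    intro t
    have := is_const_of_deriv_eq_zero (fun t => (hder t).differentiableAt)
      (fun t => (hder t).deriv) t 0
    simpa using this
  have hW : ∀ t, Real.exp t • (c t - deriv c t) = c 0 - deriv c 0 := by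
    have hder : ∀ t, HasDerivAt (fun t => Real.exp t • (c t - deriv c t)) 0 t := fun t => by
      refine ((Real.hasDerivAt_exp t).smul ((hd1 t).sub (ed' t))).congr_deriv ?_
      simp only [Pi.sub_apply]
      module
    intro t
    have := is_const_of_deriv_eq_zero (fun t => (hder t).differentiableAt)
      (fun t => (hder t).deriv) t 0
    simpa using this
  have n1 : lform (c 0 + deriv c 0) (c 0 + deriv c 0) = 0 := by
    simp only [lform_add_left, lform_add_right, lform_comm (deriv c 0) (c 0), e0, e1, e3]; norm_num
  have hsub : c 0 - deriv c 0 = c 0 + (-1 : ℝ) • deriv c 0 := by module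
  have n2 : lform (c 0 - deriv c 0) (c 0 - deriv c 0) = 0 := by
    rw [hsub]
    simp only [lform_add_left, lform_add_right, lform_smul_left, lform_smul_right,
      lform_comm (deriv c 0) (c 0), e0, e1, e3]; norm_num
  have n3 : lform (c 0 + deriv c 0) (c 0 - deriv c 0) = -2 := by
    rw [hsub]
    simp only [lform_add_left, lform_add_right, lform_smul_right,
      lform_comm (deriv c 0) (c 0), e0, e1, e3]; norm_num
  have hp : 0 < (c 0).1 := (hg 0 (mem_univ _)).1.2
  refine ⟨_, _, n1, n2, n3, fst_pos_of_null n1 n2 n3 ?_, fst_pos_of_null n2 n1 ?_ ?_, ?_⟩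
  · simp only [Prod.fst_add, Prod.fst_sub]; linarith
  · rw [lform_comm]; exact n3
  · simp only [Prod.fst_add, Prod.fst_sub]; linarith
  · intro t
    rw [← hU t, ← hW t, smul_smul, smul_smul]
    have h1 : Real.exp t / 2 * Real.exp (-t) = 1 / 2 := by
      rw [div_mul_eq_mul_div, ← Real.exp_add]; simp
    have h2 : Real.exp (-t) / 2 * Real.exp t = 1 / 2 := by
      rw [mul_comm, ← mul_div_assoc, ← Real.exp_add]; simp
    rw [h1, h2]
    module

lemma tendsto_toBall {u w : Mink n} (hu : 0 < u.1) :
    Tendsto (fun t : ℝ => toBall ((Real.exp t / 2) • u + (Real.exp (-t) / 2) • w)) atTop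
      (𝓝 (u.1⁻¹ • u.2)) := by
  have he : Tendsto (fun t : ℝ => Real.exp (-t)) atTop (𝓝 0) := Real.tendsto_exp_neg_atTop_nhds_zero
  have h1 : Tendsto (fun t : ℝ => 2 * Real.exp (-t) + u.1 + Real.exp (-t) * Real.exp (-t) * w.1)
      atTop (𝓝 (2 * 0 + u.1 + 0 * 0 * w.1)) :=
    ((he.const_mul 2).add_const _).add ((he.mul he).mul_const _)
  have h2 : Tendsto (fun t : ℝ => u.2 + (Real.exp (-t) * Real.exp (-t)) • w.2)
      atTop (𝓝 (u.2 + (0 * 0 : ℝ) • w.2)) :=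
    ((he.mul he).smul_const _).const_add _
  have h3 := (h1.inv₀ (by simpa using hu.ne')).smul h2
  simp only [mul_zero, zero_mul, zero_smul, add_zero, zero_add] at h3
  refine h3.congr fun t => ?_
  have hx : Real.exp t * Real.exp (-t) = 1 := by rw [← Real.exp_add]; simp
  have hA : 2 * Real.exp (-t) + u.1 + Real.exp (-t) * Real.exp (-t) * w.1
      = (2 * Real.exp (-t)) * (1 + (Real.exp t / 2 * u.1 + Real.exp (-t) / 2 * w.1)) := by
    linear_combination (-u.1) * hx
  have hB : u.2 + (Real.exp (-t) * Real.exp (-t)) • w.2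
      = (2 * Real.exp (-t)) • ((Real.exp t / 2) • u.2 + (Real.exp (-t) / 2) • w.2) := by
    rw [smul_add, smul_smul, smul_smul]
    have : 2 * Real.exp (-t) * (Real.exp t / 2) = 1 := by linear_combination hx
    rw [this, one_smul]
    congr 2
    ring
  simp only [toBall, Prod.fst_add, Prod.snd_add, Prod.smul_fst, Prod.smul_snd, smul_eq_mul]
  rw [hA, hB, mul_inv, smul_smul]
  congr 1
  have : (2 * Real.exp (-t)) ≠ 0 := by positivity
  field_simp

lemma inv_smul_mem_sphere {u : Mink n} (h : lform u u = 0) (hu : 0 < u.1) :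
    u.1⁻¹ • u.2 ∈ Metric.sphere (0 : EuclideanSpace ℝ (Fin (n + 1))) 1 := by
  simp only [mem_sphere_iff_norm, sub_zero, norm_smul, norm_inv, Real.norm_eq_abs,
    norm_snd_of_null h]
  exact inv_mul_cancel₀ (abs_pos.2 hu.ne').ne'

lemma UnitGeodesic.tendsto_ends (γ : UnitGeodesic n) {u w : Mink n} (hu : 0 < u.1) (hw : 0 < w.1)
    (h : ∀ t, γ.curve t = (Real.exp t / 2) • u + (Real.exp (-t) / 2) • w) :
    Tendsto (fun t => toBall (γ.curve t)) atTop (𝓝 (u.1⁻¹ • u.2)) ∧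
    Tendsto (fun t => toBall (γ.curve t)) atBot (𝓝 (w.1⁻¹ • w.2)) := by
  constructor
  · simpa only [h] using tendsto_toBall hu
  · have := (tendsto_toBall (w := u) hw).comp tendsto_neg_atBot_atTop
    refine this.congr fun t => ?_
    simp only [Function.comp, h, neg_neg]
    exact congrArg toBall (add_comm _ _)

lemma UnitGeodesic.exists_forward (γ : UnitGeodesic n) :
    ∃ p : Sph n, Tendsto (fun t => toBall (γ.curve t)) atTop (𝓝 (p : EuclideanSpace ℝ _)) := by
  obtain ⟨u, w, hu, -, -, hu1, hw1, h⟩ := γ.exists_eq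
  exact ⟨⟨_, inv_smul_mem_sphere hu hu1⟩, (γ.tendsto_ends hu1 hw1 h).1⟩

lemma UnitGeodesic.exists_backward (γ : UnitGeodesic n) :
    ∃ p : Sph n, Tendsto (fun t => toBall (γ.curve t)) atBot (𝓝 (p : EuclideanSpace ℝ _)) := by
  obtain ⟨u, w, -, hw, -, hu1, hw1, h⟩ := γ.exists_eq
  exact ⟨⟨_, inv_smul_mem_sphere hw hw1⟩, (γ.tendsto_ends hu1 hw1 h).2⟩

end aux

/-- `γ(∞) ∈ Sⁿ`: the limit of `γ(t)` in the unit ball model as `t → ∞`. -/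
def UnitGeodesic.forwardEnd {n : ℕ} (γ : UnitGeodesic n) : Sph n :=
  Classical.choose γ.exists_forward

/-- `γ(-∞) ∈ Sⁿ`: the limit of `γ(t)` in the unit ball model as `t → -∞`. -/
def UnitGeodesic.backwardEnd {n : ℕ} (γ : UnitGeodesic n) : Sph n :=
  Classical.choose γ.exists_backward

lemma UnitGeodesic.tendsto_forwardEnd {n : ℕ} (γ : UnitGeodesic n) :
    Tendsto (fun t => toBall (γ.curve t)) atTop
      (𝓝 (γ.forwardEnd : EuclideanSpace ℝ (Fin (n + 1)))) :=
  Classical.choose_spec γ.exists_forward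

lemma UnitGeodesic.tendsto_backwardEnd {n : ℕ} (γ : UnitGeodesic n) :
    Tendsto (fun t => toBall (γ.curve t)) atBot
      (𝓝 (γ.backwardEnd : EuclideanSpace ℝ (Fin (n + 1)))) :=
  Classical.choose_spec γ.exists_backward

/-- The forward Gauss map `φ₊ : 𝓛 → Sⁿ`, `φ₊([γ]) = γ(∞)`. -/
def gaussPlus {n : ℕ} : OrientedGeodesic n → Sph n :=
  Quotient.lift UnitGeodesic.forwardEnd (by
    rintro γ₁ γ₂ ⟨a, h⟩
    refine Subtype.ext (tendsto_nhds_unique γ₁.tendsto_forwardEnd ?_)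
    simp only [h]
    exact γ₂.tendsto_forwardEnd.comp (tendsto_atTop_add_const_right atTop a tendsto_id))

/-- The backward Gauss map `φ₋ : 𝓛 → Sⁿ`, `φ₋([γ]) = γ(-∞)`. -/
def gaussMinus {n : ℕ} : OrientedGeodesic n → Sph n :=
  Quotient.lift UnitGeodesic.backwardEnd (by
    rintro γ₁ γ₂ ⟨a, h⟩
    refine Subtype.ext (tendsto_nhds_unique γ₁.tendsto_backwardEnd ?_)
    simp only [h]
    exact γ₂.tendsto_backwardEnd.comp (tendsto_atBot_add_const_right atBot a tendsto_id))

/-- `F([γ]) = (γ(-∞), γ(∞))`. -/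
def endPair {n : ℕ} (ℓ : OrientedGeodesic n) : Sph n × Sph n := (gaussMinus ℓ, gaussPlus ℓ)

section aux2

variable {n : ℕ}

lemma endPair_mk (γ : UnitGeodesic n) {u w : Mink n} (hu : 0 < u.1) (hw : 0 < w.1)
    (h : ∀ t, γ.curve t = (Real.exp t / 2) • u + (Real.exp (-t) / 2) • w) :
    ((gaussPlus (Quotient.mk _ γ : OrientedGeodesic n) : Sph n) : EuclideanSpace ℝ _)
      = u.1⁻¹ • u.2 ∧
    ((gaussMinus (Quotient.mk _ γ : OrientedGeodesic n) : Sph n) : EuclideanSpace ℝ _)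
      = w.1⁻¹ • w.2 :=
  ⟨tendsto_nhds_unique γ.tendsto_forwardEnd (γ.tendsto_ends hu hw h).1,
    tendsto_nhds_unique γ.tendsto_backwardEnd (γ.tendsto_ends hu hw h).2⟩

lemma endPair_injective : Function.Injective (endPair (n := n)) := by
  intro ℓ₁ ℓ₂ h
  induction ℓ₁ using Quotient.inductionOn with | _ γ₁ => ?_
  induction ℓ₂ using Quotient.inductionOn with | _ γ₂ => ?_
  obtain ⟨u₁, w₁, -, -, huw₁, hu₁, hw₁, h₁⟩ := γ₁.exists_eq
  obtain ⟨u₂, w₂, -, -, huw₂, hu₂, hw₂, h₂⟩ := γ₂.exists_eq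
  obtain ⟨p₁, q₁⟩ := endPair_mk γ₁ hu₁ hw₁ h₁
  obtain ⟨p₂, q₂⟩ := endPair_mk γ₂ hu₂ hw₂ h₂
  simp only [endPair, Prod.mk.injEq] at h
  rw [h.2, p₂] at p₁
  rw [h.1, q₂] at q₁
  have hu : u₁ = (u₁.1 / u₂.1) • u₂ := by
    refine Prod.ext ?_ ?_
    · simp only [Prod.smul_fst, smul_eq_mul]; field_simp
    · rw [Prod.smul_snd, div_eq_mul_inv, mul_smul, p₁, smul_smul, mul_inv_cancel₀ hu₁.ne', one_smul]
  have hw : w₁ = (w₁.1 / w₂.1) • w₂ := by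
    refine Prod.ext ?_ ?_
    · simp only [Prod.smul_fst, smul_eq_mul]; field_simp
    · rw [Prod.smul_snd, div_eq_mul_inv, mul_smul, q₁, smul_smul, mul_inv_cancel₀ hw₁.ne', one_smul]
  set a := u₁.1 / u₂.1 with ha
  set b := w₁.1 / w₂.1 with hb
  have ha0 : 0 < a := div_pos hu₁ hu₂
  have hab : a * b = 1 := by
    have := huw₁
    rw [hu, hw, lform_smul_left, lform_smul_right, huw₂] at this
    linarith
  refine Quotient.sound ⟨Real.log a, fun t => ?_⟩
  rw [h₁, h₂, hu, hw, smul_smul, smul_smul, neg_add, Real.exp_add, Real.exp_add, Real.exp_log ha0,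
    Real.exp_neg (Real.log a), Real.exp_log ha0]
  have : b = a⁻¹ := eq_inv_of_mul_eq_one_right hab
  rw [this]
  congr 2 <;> ring

lemma exists_geodesic {u w : Mink n} (huu : lform u u = 0) (hww : lform w w = 0)
    (huw : lform u w = -2) (hu : 0 < u.1) (hw : 0 < w.1) : ∃ γ : UnitGeodesic n,
    ∀ t, γ.curve t = (Real.exp t / 2) • u + (Real.exp (-t) / 2) • w := by
  set c : ℝ → Mink n := fun t => (Real.exp t / 2) • u + (Real.exp (-t) / 2) • w with hc
  have hx : ∀ t : ℝ, Real.exp t * Real.exp (-t) = 1 := fun t => by rw [← Real.exp_add]; simp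
  have hexp : ∀ t : ℝ, HasDerivAt (fun t => Real.exp (-t) / 2) (-(Real.exp (-t) / 2)) t := fun t => by
    refine ((hasDerivAt_neg t).exp.div_const 2).congr_deriv ?_
    ring
  have hd1 : deriv c = fun t => (Real.exp t / 2) • u - (Real.exp (-t) / 2) • w := by
    funext t
    refine HasDerivAt.deriv ?_
    refine ((((Real.hasDerivAt_exp t).div_const 2).smul_const u).add
      ((hexp t).smul_const w)).congr_deriv ?_
    module
  have hd2 : deriv (deriv c) = c := by
    rw [hd1]
    funext t
    refine HasDerivAt.deriv ?_
    refine ((((Real.hasDerivAt_exp t).div_const 2).smul_const u).sub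
      ((hexp t).smul_const w)).congr_deriv ?_
    simp only [hc]
    module
  have hcc : ∀ t, lform (c t) (c t) = -1 := fun t => by
    simp only [hc, lform_add_left, lform_add_right, lform_smul_left, lform_smul_right, huu, hww,
      lform_comm w u, huw]
    linear_combination (-1) * hx t
  refine ⟨⟨c, ⟨?_, fun t _ => ⟨⟨hcc t, ?_⟩, ?_⟩⟩, fun t => ?_⟩, fun t => rfl⟩
  · refine ContDiff.contDiffOn ?_
    simp only [hc]
    fun_prop
  · simp only [hc, Prod.fst_add, Prod.smul_fst, smul_eq_mul]
    positivity
  · rw [hd2, tanProj, hcc]; module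
  · rw [lnorm, Real.sqrt_eq_one]
    have : lform (deriv c t) (deriv c t) = 1 := by
      have e : deriv c t = (Real.exp t / 2) • u + (-(Real.exp (-t) / 2)) • w := by
        rw [hd1]; module
      rw [e]
      simp only [lform_add_left, lform_add_right, lform_smul_left, lform_smul_right, huu, hww,
        lform_comm w u, huw]
      linear_combination hx t
    rw [this, abs_one]

lemma range_endPair : range (endPair (n := n)) = {x | x.1 ≠ x.2} := by
  ext ⟨p, q⟩
  have hp : ‖(p : EuclideanSpace ℝ (Fin (n + 1)))‖ = 1 := by simp
  have hq : ‖(q : EuclideanSpace ℝ (Fin (n + 1)))‖ = 1 := by simp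
  constructor
  · rintro ⟨ℓ, h⟩ (heq : p = q)
    induction ℓ using Quotient.inductionOn with | _ γ => ?_
    obtain ⟨u, w, huu, hww, huw, hu, hw, h'⟩ := γ.exists_eq
    obtain ⟨h1, h2⟩ := endPair_mk γ hu hw h'
    simp only [endPair, Prod.mk.injEq] at h
    rw [h.2] at h1
    rw [h.1, heq, h1] at h2
    have hw2 : w = (w.1 / u.1) • u := by
      refine Prod.ext ?_ ?_
      · simp only [Prod.smul_fst, smul_eq_mul]; field_simp
      · rw [Prod.smul_snd, div_eq_mul_inv, mul_smul, h2, smul_smul, mul_inv_cancel₀ hw.ne',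
          one_smul]
    rw [hw2, lform_smul_right, huu] at huw
    norm_num at huw
  · intro (hne : p ≠ q)
    have hlt : inner ℝ (p : EuclideanSpace ℝ (Fin (n + 1))) (q : EuclideanSpace ℝ (Fin (n + 1))) < 1 :=
      (inner_lt_one_iff_real_of_norm_eq_one hp hq).2 fun h => hne (Subtype.ext h)
    set s := inner ℝ (p : EuclideanSpace ℝ (Fin (n + 1))) (q : EuclideanSpace ℝ (Fin (n + 1)))
      with hs
    have h1s : 0 < 1 - s := by linarith
    let U : Mink n := (1, (q : EuclideanSpace ℝ (Fin (n + 1))))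
    let W : Mink n := (2 / (1 - s)) • ((1, (p : EuclideanSpace ℝ (Fin (n + 1)))) : Mink n)
    have hU : 0 < U.1 := one_pos
    have hW1 : W.1 = 2 / (1 - s) := by simp [W]
    have hW : 0 < W.1 := by rw [hW1]; positivity
    obtain ⟨γ, hγ⟩ := exists_geodesic (u := U) (w := W) (by simp [lform, U])
      (by rw [lform_smul_left, lform_smul_right]; simp [lform])
      (by
        rw [lform_smul_right]
        simp only [lform, U, real_inner_comm]
        rw [← hs]; field_simp; ring)
      hU hW
    obtain ⟨h1, h2⟩ := endPair_mk γ hU hW hγ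
    refine ⟨Quotient.mk _ γ, Prod.ext (Subtype.ext ?_) (Subtype.ext ?_)⟩
    · refine h2.trans ?_
      rw [hW1]
      simp only [W, Prod.smul_snd]
      rw [smul_smul, inv_mul_cancel₀ (by positivity), one_smul]
    · refine h1.trans ?_
      simp [U]

end aux2

/-! ### The manifold structure of `𝓛`

`F : 𝓛 → Sⁿ × Sⁿ` is injective with image the open set `{(p, q) | p ≠ q}`; the topology and the
smooth structure of the `2n`-dimensional manifold `𝓛` are those for which `F` is a diffeomorphism
onto this open set. -/

instance OrientedGeodesic.topologicalSpace (n : ℕ) : TopologicalSpace (OrientedGeodesic n) :=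
  TopologicalSpace.induced endPair inferInstance

lemma isOpenEmbedding_endPair (n : ℕ) : IsOpenEmbedding (endPair (n := n)) :=
  ⟨⟨⟨rfl⟩, endPair_injective⟩, by
    rw [range_endPair]; exact isOpen_ne_fun continuous_fst continuous_snd⟩

instance OrientedGeodesic.nonempty (n : ℕ) : Nonempty (OrientedGeodesic n) := by
  obtain ⟨p⟩ : Nonempty (Sph n) := (NormedSpace.sphere_nonempty.2 zero_le_one).to_subtype
  have hmem : ((-p, p) : Sph n × Sph n) ∈ range (endPair (n := n)) := by
    rw [range_endPair]
    exact fun h => ne_neg_of_mem_unit_sphere ℝ p (Eq.symm h)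
  exact ⟨hmem.choose⟩

/-- The charts of `𝓛` are the compositions of `F` with the product charts of `Sⁿ × Sⁿ`. -/
instance OrientedGeodesic.chartedSpace (n : ℕ) :
    ChartedSpace (ModelProd (EuclideanSpace ℝ (Fin n)) (EuclideanSpace ℝ (Fin n)))
      (OrientedGeodesic n) :=
  letI : ChartedSpace (Sph n × Sph n) (OrientedGeodesic n) :=
    (isOpenEmbedding_endPair n).singletonChartedSpace
  ChartedSpace.comp _ (Sph n × Sph n) _

instance OrientedGeodesic.isManifold (n : ℕ) :
    IsManifold ((𝓡 n).prod (𝓡 n)) ∞ (OrientedGeodesic n) := by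
  refine isManifold_of_contDiffOn _ _ _ ?_
  rintro e e' ⟨f, rfl : f = _, c, hc, rfl⟩ ⟨f', rfl : f' = _, c', hc', rfl⟩
  set f := (isOpenEmbedding_endPair n).toOpenPartialHomeomorph endPair
  have hG := (contDiffGroupoid ∞ ((𝓡 n).prod (𝓡 n))).compatible hc hc'
  rw [contDiffGroupoid, mem_groupoid_of_pregroupoid] at hG
  have h : ContDiffOn ℝ ∞ (((𝓡 n).prod (𝓡 n)) ∘ (c.symm ≫ₕ c') ∘ ((𝓡 n).prod (𝓡 n)).symm)
    (((𝓡 n).prod (𝓡 n)).symm ⁻¹' (c.symm ≫ₕ c').source ∩ range ((𝓡 n).prod (𝓡 n))) := hG.1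
  refine h.congr_mono ?_ ?_
  · rintro x ⟨hx, -⟩
    simp only [mem_preimage, OpenPartialHomeomorph.trans_source, mem_inter_iff,
      OpenPartialHomeomorph.trans_symm_eq_symm_trans_symm, OpenPartialHomeomorph.symm_source] at hx
    simp only [Function.comp, OpenPartialHomeomorph.coe_trans,
      OpenPartialHomeomorph.trans_symm_eq_symm_trans_symm]
    rw [f.right_inv hx.1.2]
  · rintro x ⟨hx, hx'⟩
    refine ⟨?_, hx'⟩
    simp only [mem_preimage, OpenPartialHomeomorph.trans_source, mem_inter_iff,
      OpenPartialHomeomorph.trans_symm_eq_symm_trans_symm, OpenPartialHomeomorph.symm_source,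
      Function.comp, OpenPartialHomeomorph.coe_trans] at hx ⊢
    rw [f.right_inv hx.1.2] at hx
    exact ⟨hx.1.1, hx.2.2⟩

/-! ### Geodesic foliations -/

/-- `V` defines a smooth geodesic foliation of `Hyp n`: its restriction to `Hyp n` is a smooth unit
tangent vector field all of whose integral curves are geodesics. The field is given as a function
on Minkowski space that is smooth near `Hyp n`; every smooth vector field along the closed
submanifold `Hyp n` is of this form, and only the values on `Hyp n` matter below. -/
structure IsGeodesicFoliation {n : ℕ} (V : Mink n → Mink n) : Prop where
  smooth : ∃ U, IsOpen U ∧ Hyp n ⊆ U ∧ ContDiffOn ℝ ∞ V U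
  tangent : ∀ x ∈ Hyp n, lform x (V x) = 0
  unit : ∀ x ∈ Hyp n, lnorm (V x) = 1
  geodesic : ∀ (γ : ℝ → Mink n) (a b : ℝ),
    (∀ t ∈ Ioo a b, γ t ∈ Hyp n ∧ HasDerivAt γ (V (γ t)) t) → IsGeodesicOn γ (Ioo a b)

/-- A t.e.r. geodesic foliation: `|∇_v V| < |v|` for every nonzero tangent vector `v`. -/
structure IsTERFoliation {n : ℕ} (V : Mink n → Mink n) : Prop extends IsGeodesicFoliation V where
  ter : ∀ x ∈ Hyp n, ∀ v, lform x v = 0 → v ≠ 0 → lnorm (covDeriv V x v) < lnorm v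

/-- The subset `𝓜` of `𝓛` whose elements are the leaves of the foliation defined by `V`, that is
the oriented geodesics that are integral curves of `V`. -/
def leafSet {n : ℕ} (V : Mink n → Mink n) : Set (OrientedGeodesic n) :=
  {ℓ | ∃ γ : UnitGeodesic n, Quotient.mk _ γ = ℓ ∧
    ∀ t, HasDerivAt γ.curve (V (γ.curve t)) t}

/-- The charts `cs` make the subset `M` of `𝓛`, with the subspace topology, an embedded smooth
submanifold of dimension `k`. -/
def IsSubmanifoldStructure {n : ℕ} (k : ℕ) (M : Set (OrientedGeodesic n))
    (cs : ChartedSpace (EuclideanSpace ℝ (Fin k)) M) : Prop :=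
  IsManifold (𝓡 k) ∞ M ∧
    Manifold.IsSmoothEmbedding (𝓡 k) ((𝓡 n).prod (𝓡 n)) ∞ (Subtype.val : M → OrientedGeodesic n)

end

/-! In the hyperboloid model the leaf through `x` has its ends on the null lines spanned by `x + V
x` and `x - V x`. Take `x₀` on a leaf and `v₀ = V x₀`. The totally geodesic hypersurface `⟨y, v₀⟩ =
0` is transversal to the leaves near `x₀` and parametrizes them. Let `v` be tangent to it at `x₀`.
To first order the forward or backward end (`s = 1` or `s = -1`) moves by `v + s • ∇_v V` modulo `x₀
+ s • V x₀`. If this vanishes, pairing with `V x₀` gives `∇_v V = -s • v`, which `|∇_v V| < |v|`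
forbids unless `v = 0`. Hence both end maps are local diffeomorphisms from the transversal to `Sⁿ`;
this is `IsTERFoliation.fderiv_transversalMap_injective`, stated for an extension to Minkowski space
so that the inverse function theorem applies in a vector space.

An oriented geodesic that crosses the hypersurface positively does so at one point, which depends
continuously on it (`continuousOn_footPoint`). So the leaves near a given one, for the topology of
`𝓛`, are exactly those through nearby points of the transversal, and `IsTERFoliation.exists_chart`
makes each Gauss map a local homeomorphism on `𝓜` with inverse smooth into `𝓛`.

Consequently `𝓜` is locally the graph of a smooth map from the forward end to the backward end,
hence an embedded submanifold (`exists_isSubmanifoldStructure`). For an arbitrary submanifold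
structure, the inverses lift smoothly through the immersion `𝓜 → 𝓛`
(`isLocalDiffeomorph_of_charts`). -/

/-! ### Smooth maps into the sphere. -/

section Sphere

variable {n : ℕ} {F H M : Type*} [NormedAddCommGroup F] [NormedSpace ℝ F] [TopologicalSpace H]
  {I : ModelWithCorners ℝ F H} [TopologicalSpace M] [ChartedSpace H M]

/-- Smoothness of a map into the sphere can be tested in the ambient Euclidean space. -/
theorem contMDiffAt_sphere_of_coe {f : M → Sph n} {x : M}
    (hf : ContMDiffAt I 𝓘(ℝ, EuclideanSpace ℝ (Fin (n + 1))) ∞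
      (fun y => (f y : EuclideanSpace ℝ (Fin (n + 1)))) x) :
    ContMDiffAt I (𝓡 n) ∞ f x := by
  rw [contMDiffAt_iff_target]
  refine ⟨IsInducing.subtypeVal.continuousAt_iff.2 hf.continuousAt, ?_⟩
  have : Fact (Module.finrank ℝ (EuclideanSpace ℝ (Fin (n + 1))) = n + 1) :=
    ⟨finrank_euclideanSpace_fin⟩
  set v : Sph n := f x
  let U : _ ≃ₗᵢ[ℝ] _ := (OrthonormalBasis.fromOrthogonalSpanSingleton
        n (ne_zero_of_mem_unit_sphere (-v))).repr
  -- The chart at `v` is stereographic projection from `-v`, which is smooth in the ambient space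
  -- away from `⟨-v, ·⟩ = 1`; at `v` this product is `-1`.
  have hne : innerSL ℝ ((-v : Sph n) : EuclideanSpace ℝ (Fin (n + 1))) (f x) ≠ (1 : ℝ) := by
    have : inner ℝ (v : EuclideanSpace ℝ (Fin (n + 1))) v = (1 : ℝ) := by
      rw [real_inner_self_eq_norm_sq]; simp
    rw [innerSL_apply_apply]
    change inner ℝ (-(v : EuclideanSpace ℝ (Fin (n + 1)))) v ≠ (1 : ℝ)
    rw [inner_neg_left, this]; norm_num
  have H₁ : ContDiffAt ℝ ∞ (stereoToFun ((-v : Sph n) : EuclideanSpace ℝ (Fin (n + 1))))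
      (f x : EuclideanSpace ℝ (Fin (n + 1))) :=
    (contDiffOn_stereoToFun (n := ∞)).contDiffAt
      ((isOpen_ne_fun (innerSL ℝ _).continuous continuous_const).mem_nhds hne)
  have H₂ : ContDiff ℝ ∞ U := U.contDiff
  have H₃ := (H₂.contDiffAt.comp _ H₁).contMDiffAt
  exact ContMDiffAt.comp (g := U ∘ stereoToFun ((-v : Sph n) : EuclideanSpace ℝ (Fin (n + 1))))
    (f := fun y => (f y : EuclideanSpace ℝ (Fin (n + 1)))) x H₃ hf

end Sphere

/-! ### Smooth maps into and out of `𝓛`, and lifting through immersions. -/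

section EndPair

variable {n : ℕ} {F H M : Type*} [NormedAddCommGroup F] [NormedSpace ℝ F] [TopologicalSpace H]
  {I : ModelWithCorners ℝ F H} [TopologicalSpace M] [ChartedSpace H M]

/-- The charts of `𝓛` are product charts composed with `endPair`, so both sides have the same
coordinate expression; continuity agrees because the topology is induced. -/
theorem contMDiffAt_iff_endPair {f : M → OrientedGeodesic n} {x : M} :
    ContMDiffAt I ((𝓡 n).prod (𝓡 n)) ∞ f x ↔
      ContMDiffAt I ((𝓡 n).prod (𝓡 n)) ∞ (fun y => endPair (f y)) x := by
  rw [contMDiffAt_iff, contMDiffAt_iff]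
  refine and_congr ((isOpenEmbedding_endPair n).isInducing.continuousAt_iff) Iff.rfl

theorem contMDiff_endPair (n : ℕ) :
    ContMDiff ((𝓡 n).prod (𝓡 n)) ((𝓡 n).prod (𝓡 n)) ∞ (endPair (n := n)) :=
  fun _ => contMDiffAt_iff_endPair.1 contMDiffAt_id

theorem contMDiff_gaussPlus (n : ℕ) :
    ContMDiff ((𝓡 n).prod (𝓡 n)) (𝓡 n) ∞ (gaussPlus (n := n)) :=
  contMDiff_snd.comp (contMDiff_endPair n)

theorem contMDiff_gaussMinus (n : ℕ) :
    ContMDiff ((𝓡 n).prod (𝓡 n)) (𝓡 n) ∞ (gaussMinus (n := n)) :=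
  contMDiff_fst.comp (contMDiff_endPair n)

/-- A continuous map into the source of an immersion is smooth as soon as its composite with the
immersion is. This makes `e.symm` smooth for whatever structure `X` carries, so uniqueness of that
structure is not needed. -/
theorem isLocalDiffeomorph_of_charts {X : Type*} [TopologicalSpace X]
    [ChartedSpace (EuclideanSpace ℝ (Fin n)) X] {ι : X → OrientedGeodesic n}
    (hι : Manifold.IsImmersion (𝓡 n) ((𝓡 n).prod (𝓡 n)) ∞ ι)
    {φ : OrientedGeodesic n → Sph n} (hφ : ContMDiff ((𝓡 n).prod (𝓡 n)) (𝓡 n) ∞ φ)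
    (h : ∀ x : X, ∃ e : OpenPartialHomeomorph X (Sph n), x ∈ e.source ∧
      (∀ y ∈ e.source, e y = φ (ι y)) ∧
      ContMDiffOn (𝓡 n) ((𝓡 n).prod (𝓡 n)) ∞ (fun q => ι (e.symm q)) e.target) :
    IsLocalDiffeomorph (𝓡 n) (𝓡 n) ∞ (fun x => φ (ι x)) := by
  intro x
  obtain ⟨e, hx, he, hs⟩ := h x
  refine ⟨⟨e.toPartialEquiv, e.open_source, e.open_target, ?_, ?_⟩, hx, fun y hy => (he y hy).symm⟩
  · exact ((hφ.comp hι.contMDiff).contMDiffOn).congr he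
  · intro q hq
    refine ContMDiffAt.contMDiffWithinAt ?_
    refine (ContMDiffAt.iff_comp_isImmersionAt (hι.isImmersionAt _)).2 ⟨e.symm.continuousAt hq, ?_⟩
    exact hs.contMDiffAt (e.open_target.mem_nhds hq)

end EndPair

/-! ### Manifold structures pulled back from the sphere. -/

section ChartedSpace

variable {n : ℕ} {X : Type*} [TopologicalSpace X]

/-- The charts pulled back from the sphere by a family of partial homeomorphisms. -/
noncomputable abbrev chartedSpaceOfSphere (e : X → OpenPartialHomeomorph X (Sph n))
    (he : ∀ x, x ∈ (e x).source) : ChartedSpace (EuclideanSpace ℝ (Fin n)) X :=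
  letI : ChartedSpace (Sph n) X :=
    { atlas := range e
      chartAt := e
      mem_chart_source := he
      chart_mem_atlas := fun x => mem_range_self x }
  ChartedSpace.comp _ (Sph n) _

/-- All the `e x` are restrictions of the single map `φ`, so they agree on overlaps and the
transition maps are those of the sphere. -/
theorem isManifold_chartedSpaceOfSphere {φ : X → Sph n}
    (e : X → OpenPartialHomeomorph X (Sph n)) (he : ∀ x, x ∈ (e x).source)
    (hφ : ∀ x, ∀ y ∈ (e x).source, e x y = φ y) :
    let _ := chartedSpaceOfSphere e he
    IsManifold (𝓡 n) ∞ X := by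
  let _ := chartedSpaceOfSphere e he
  refine isManifold_of_contDiffOn _ _ _ ?_
  rintro _ _ ⟨_, ⟨x, rfl⟩, c, hc, rfl⟩ ⟨_, ⟨x', rfl⟩, c', hc', rfl⟩
  have hG := (contDiffGroupoid ∞ (𝓡 n)).compatible hc hc'
  rw [contDiffGroupoid, mem_groupoid_of_pregroupoid] at hG
  have h : ContDiffOn ℝ ∞ ((𝓡 n) ∘ (c.symm ≫ₕ c') ∘ (𝓡 n).symm)
    ((𝓡 n).symm ⁻¹' (c.symm ≫ₕ c').source ∩ range (𝓡 n)) := hG.1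
  have key : ∀ q ∈ (e x).target, (e x).symm q ∈ (e x').source → e x' ((e x).symm q) = q := by
    intro q hq hq'
    rw [hφ _ _ hq', ← hφ x _ ((e x).map_target hq), (e x).right_inv hq]
  refine h.congr_mono ?_ ?_
  · rintro y ⟨hy, -⟩
    simp only [mem_preimage, OpenPartialHomeomorph.trans_source, mem_inter_iff,
      OpenPartialHomeomorph.trans_symm_eq_symm_trans_symm, OpenPartialHomeomorph.symm_source,
      Function.comp, OpenPartialHomeomorph.coe_trans] at hy
    simp only [Function.comp, OpenPartialHomeomorph.coe_trans,
      OpenPartialHomeomorph.trans_symm_eq_symm_trans_symm]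
    rw [key _ hy.1.2 hy.2.1]
  · rintro y ⟨hy, hy'⟩
    refine ⟨?_, hy'⟩
    simp only [mem_preimage, OpenPartialHomeomorph.trans_source, mem_inter_iff,
      OpenPartialHomeomorph.trans_symm_eq_symm_trans_symm, OpenPartialHomeomorph.symm_source,
      Function.comp, OpenPartialHomeomorph.coe_trans] at hy ⊢
    rw [key _ hy.1.2 hy.2.1] at hy
    exact ⟨hy.1.1, hy.2.2⟩

end ChartedSpace

/-! ### Straightening a graph. -/

section Shear

variable {E F : Type*} [NormedAddCommGroup E] [NormedSpace ℝ E] [NormedAddCommGroup F]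
  [NormedSpace ℝ F]

/-- The map `(a, b) ↦ (b, a - g b)`, which straightens the graph of `g`. -/
@[simps]
def shear {g : E → E} {s : Set E} (hs : IsOpen s) (hg : ContinuousOn g s) :
    OpenPartialHomeomorph (E × E) (E × E) where
  toFun x := (x.2, x.1 - g x.2)
  invFun x := (x.2 + g x.1, x.1)
  source := univ ×ˢ s
  target := s ×ˢ univ
  map_source' x hx := ⟨hx.2, mem_univ _⟩
  map_target' x hx := ⟨mem_univ _, hx.1⟩
  left_inv' x _ := by simp
  right_inv' x _ := by simp
  open_source := isOpen_univ.prod hs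
  open_target := hs.prod isOpen_univ
  continuousOn_toFun := continuousOn_snd.prodMk
    (continuousOn_fst.sub (hg.comp continuousOn_snd fun x hx => hx.2))
  continuousOn_invFun := (continuousOn_snd.add
    (hg.comp continuousOn_fst fun x hx => hx.1)).prodMk continuousOn_fst

theorem shear_mem_contDiffGroupoid {n : ℕ} {g : EuclideanSpace ℝ (Fin n) → EuclideanSpace ℝ (Fin n)}
    {s : Set (EuclideanSpace ℝ (Fin n))} (hs : IsOpen s) (hg : ContDiffOn ℝ ∞ g s) :
    (shear hs hg.continuousOn : OpenPartialHomeomorph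
      (ModelProd (EuclideanSpace ℝ (Fin n)) (EuclideanSpace ℝ (Fin n))) _) ∈
      contDiffGroupoid ∞ ((𝓡 n).prod (𝓡 n)) := by
  rw [contDiffGroupoid, mem_groupoid_of_pregroupoid]
  constructor
  · have : ContDiffOn ℝ ∞ (fun x : EuclideanSpace ℝ (Fin n) × EuclideanSpace ℝ (Fin n) =>
        (x.2, x.1 - g x.2)) (univ ×ˢ s) :=
      contDiffOn_snd.prodMk (contDiffOn_fst.sub (hg.comp contDiffOn_snd fun x hx => hx.2))
    exact this.mono fun x hx => hx.1
  · have : ContDiffOn ℝ ∞ (fun x : EuclideanSpace ℝ (Fin n) × EuclideanSpace ℝ (Fin n) =>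
        (x.2 + g x.1, x.1)) (s ×ˢ univ) :=
      (contDiffOn_snd.add (hg.comp contDiffOn_fst fun x hx => hx.1)).prodMk contDiffOn_fst
    exact this.mono fun x hx => hx.1

theorem trans_mem_maximalAtlas {H M : Type*} [TopologicalSpace H] [TopologicalSpace M]
    [ChartedSpace H M] {G : StructureGroupoid H} {c : OpenPartialHomeomorph M H}
    (hc : c ∈ G.maximalAtlas M) {s : OpenPartialHomeomorph H H} (hs : s ∈ G) :
    c ≫ₕ s ∈ G.maximalAtlas M := by
  intro c' hc'
  obtain ⟨h1, h2⟩ := hc c' hc'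
  constructor
  · have := G.trans (G.symm hs) h1
    rwa [← OpenPartialHomeomorph.trans_assoc,
      ← OpenPartialHomeomorph.trans_symm_eq_symm_trans_symm] at this
  · have := G.trans h2 hs
    rwa [OpenPartialHomeomorph.trans_assoc] at this

end Shear

/-! ### Local graphs over the forward end are embedded submanifolds. -/

section Submanifold

variable {n : ℕ} {M : Set (OrientedGeodesic n)}

/-- In the coordinates (backward end, forward end) the set `M` is locally the graph of `g` over the
second factor. The shear sends it to the slice `(y, 0)`, the normal form of an immersion with
`n`-dimensional complement. The embedding property is that of the subspace topology. -/
theorem exists_isSubmanifoldStructure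
    (h : ∀ ℓ : M, ∃ e : OpenPartialHomeomorph M (Sph n), ℓ ∈ e.source ∧
      (∀ y ∈ e.source, e y = gaussPlus (y : OrientedGeodesic n)) ∧
      ContMDiffOn (𝓡 n) ((𝓡 n).prod (𝓡 n)) ∞ (fun q => (e.symm q : OrientedGeodesic n)) e.target) :
    ∃ cs : ChartedSpace (EuclideanSpace ℝ (Fin n)) M, IsSubmanifoldStructure n M cs := by
  choose e he hφ hsm using h
  let _ := chartedSpaceOfSphere e he
  have hM : IsManifold (𝓡 n) ∞ M := isManifold_chartedSpaceOfSphere e he hφ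
  refine ⟨inferInstance, hM, ?_, IsEmbedding.subtypeVal⟩
  refine Manifold.IsImmersionOfComplement.isImmersion (F := EuclideanSpace ℝ (Fin n)) fun ℓ => ?_
  set p : Sph n := gaussMinus (ℓ : OrientedGeodesic n)
  set q : Sph n := e ℓ ℓ with hq
  have hqp : q = gaussPlus (ℓ : OrientedGeodesic n) := hφ ℓ ℓ (he ℓ)
  let cp := chartAt (EuclideanSpace ℝ (Fin n)) p
  let cq := chartAt (EuclideanSpace ℝ (Fin n)) q
  -- the graph map in charts
  let b : Sph n → Sph n := fun y => gaussMinus ((e ℓ).symm y : OrientedGeodesic n)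
  have hb : ContMDiffOn (𝓡 n) (𝓡 n) ∞ b (e ℓ).target :=
    (contMDiff_gaussMinus n).comp_contMDiffOn (hsm ℓ)
  let W : Set (Sph n) := cq.source ∩ ((e ℓ).target ∩ b ⁻¹' cp.source)
  have hW : IsOpen W := cq.open_source.inter
    (hb.continuousOn.isOpen_inter_preimage (e ℓ).open_target cp.open_source)
  have hqW : q ∈ W := by
    refine ⟨mem_chart_source _ q, (e ℓ).map_source (he ℓ), ?_⟩
    change gaussMinus ((e ℓ).symm (e ℓ ℓ) : OrientedGeodesic n) ∈ cp.source
    rw [(e ℓ).left_inv (he ℓ)]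
    exact mem_chart_source _ p
  let s : Set (EuclideanSpace ℝ (Fin n)) := cq.target ∩ cq.symm ⁻¹' W
  have hs : IsOpen s := cq.symm.isOpen_inter_preimage hW
  let g : EuclideanSpace ℝ (Fin n) → EuclideanSpace ℝ (Fin n) := cp ∘ b ∘ cq.symm
  have hg : ContDiffOn ℝ ∞ g s := by
    rw [← contMDiffOn_iff_contDiffOn]
    refine (contMDiffOn_chart (x := p)).comp (t := cp.source) (hb.comp (t := (e ℓ).target)
      ((contMDiffOn_chart_symm (x := q)).mono fun y hy => hy.1) fun y hy => hy.2.2.1)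
      fun y hy => hy.2.2.2
  have hdom : (chartAt (EuclideanSpace ℝ (Fin n)) ℓ) = e ℓ ≫ₕ cq := rfl
  have hcod : (chartAt (ModelProd (EuclideanSpace ℝ (Fin n)) (EuclideanSpace ℝ (Fin n)))
      (ℓ : OrientedGeodesic n)) = (isOpenEmbedding_endPair n).toOpenPartialHomeomorph endPair ≫ₕ
        (cp.prod cq) := by
    have : cq = chartAt (EuclideanSpace ℝ (Fin n)) (gaussPlus (ℓ : OrientedGeodesic n)) := by
      rw [← hqp]
    rw [this]; rfl
  -- The domain chart is cut down so that its image stays where `g` is defined and smooth.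
  let D := (chartAt (EuclideanSpace ℝ (Fin n)) ℓ).restr ((e ℓ).source ∩ (e ℓ) ⁻¹' W)
  have hWo : IsOpen ((e ℓ).source ∩ (e ℓ) ⁻¹' W) := (e ℓ).isOpen_inter_preimage hW
  refine Manifold.IsImmersionAtOfComplement.mk_of_continuousAt continuousAt_subtype_val
    (ContinuousLinearEquiv.refl ℝ _) D
    (chartAt (ModelProd (EuclideanSpace ℝ (Fin n)) (EuclideanSpace ℝ (Fin n)))
      (ℓ : OrientedGeodesic n) ≫ₕ shear hs hg.continuousOn) ?_ ?_ ?_ ?_ ?_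
  · rw [OpenPartialHomeomorph.restr_source, hWo.interior_eq]
    exact ⟨mem_chart_source _ ℓ, he ℓ, hqW⟩
  · rw [OpenPartialHomeomorph.trans_source]
    refine ⟨mem_chart_source _ _, ?_⟩
    rw [hcod]
    refine ⟨mem_univ _, ?_⟩
    change cq (gaussPlus (ℓ : OrientedGeodesic n)) ∈ s
    rw [← hqp]
    exact ⟨mem_chart_target _ q, by
      change cq.symm (cq q) ∈ W
      rw [cq.left_inv (mem_chart_source _ q)]; exact hqW⟩
  · exact restr_mem_maximalAtlas _ (IsManifold.chart_mem_maximalAtlas ℓ) hWo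
  · exact trans_mem_maximalAtlas (IsManifold.chart_mem_maximalAtlas _)
      (shear_mem_contDiffGroupoid hs hg)
  -- The leaf with coordinate `y` has coordinates `(g y, y)` in `𝓛`, which the shear turns into `(y,
  -- g y - g y)`.
  · intro y hy
    have hy' : y ∈ D.target := by
      simpa only [OpenPartialHomeomorph.extend_target, modelWithCornersSelf_coe_symm, preimage_id,
        modelWithCornersSelf_coe, range_id, inter_univ, id] using hy
    have hy1 : y ∈ (e ℓ ≫ₕ cq).target := hy'.1
    have hyq : y ∈ cq.target := hy1.1
    have hm : (e ℓ).symm (cq.symm y) ∈ (e ℓ).source := (e ℓ).map_target hy1.2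
    have hplus : gaussPlus ((e ℓ).symm (cq.symm y) : OrientedGeodesic n) = cq.symm y := by
      rw [← hφ ℓ _ hm, (e ℓ).right_inv hy1.2]
    have hcq : chartAt (EuclideanSpace ℝ (Fin n)) (gaussPlus (ℓ : OrientedGeodesic n)) = cq := by
      rw [← hqp]
    refine Prod.ext ?_ ?_
    · change chartAt (EuclideanSpace ℝ (Fin n)) (gaussPlus (ℓ : OrientedGeodesic n))
        (gaussPlus ((e ℓ).symm (cq.symm y) : OrientedGeodesic n)) = y
      rw [hcq, hplus, cq.right_inv hyq]
    · change cp (gaussMinus ((e ℓ).symm (cq.symm y) : OrientedGeodesic n)) -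
        g (chartAt (EuclideanSpace ℝ (Fin n)) (gaussPlus (ℓ : OrientedGeodesic n))
        (gaussPlus ((e ℓ).symm (cq.symm y) : OrientedGeodesic n))) = 0
      rw [hcq, hplus, cq.right_inv hyq]
      exact sub_self _

end Submanifold

/-! ### The hyperboloid and the radial projection onto it. -/

section Hyperboloid

variable {n : ℕ}

theorem ContDiffOn.lform {E : Type*} [NormedAddCommGroup E] [NormedSpace ℝ E] {f g : E → Mink n}
    {s : Set E} (hf : ContDiffOn ℝ ∞ f s) (hg : ContDiffOn ℝ ∞ g s) :
    ContDiffOn ℝ ∞ (fun y => lform (f y) (g y)) s :=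
  (hf.snd.inner ℝ hg.snd).sub (hf.fst.mul hg.fst)

theorem continuous_lform_self : Continuous fun y : Mink n => lform y y := by
  unfold lform; fun_prop

/-- Cauchy–Schwarz for the space components reads `x₀² v₀² ≤ (x₀² - 1) D`, with `D` the square of
the space part of `v`. Hence `x₀² (D - v₀²) ≥ D ≥ 0`. -/
theorem lform_self_nonneg_of_tangent {x v : Mink n} (hx : x ∈ Hyp n) (hv : lform x v = 0) :
    0 ≤ lform v v := by
  obtain ⟨a0, hp⟩ := hx
  have cs := real_inner_mul_inner_self_le x.2 v.2
  simp only [lform] at a0 hv ⊢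
  set A := inner ℝ x.2 x.2
  set B := inner ℝ x.2 v.2
  set D := inner ℝ v.2 v.2
  have hA : A = x.1 * x.1 - 1 := by linarith
  have hB : B = x.1 * v.1 := by linarith
  have hD : 0 ≤ D := real_inner_self_nonneg
  rw [hA, hB] at cs
  have : 0 ≤ (x.1 * x.1) * (D - v.1 * v.1) := by nlinarith
  exact nonneg_of_mul_nonneg_right this (mul_pos hp hp)

/-- The radial projection of the open future cone onto the hyperboloid. -/
noncomputable def radialProj (y : Mink n) : Mink n := (Real.sqrt (-lform y y))⁻¹ • y

/-- The open future cone of Minkowski space. -/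
def futureCone (n : ℕ) : Set (Mink n) := {y | lform y y < 0 ∧ 0 < y.1}

theorem isOpen_futureCone : IsOpen (futureCone n) :=
  (isOpen_lt continuous_lform_self continuous_const).inter (isOpen_lt continuous_const continuous_fst)

theorem Hyp_subset_futureCone : Hyp n ⊆ futureCone n := fun x hx => ⟨by rw [hx.1]; norm_num, hx.2⟩

theorem radialProj_mem {y : Mink n} (hy : y ∈ futureCone n) : radialProj y ∈ Hyp n := by
  have h : 0 < -lform y y := by linarith [hy.1]
  have h' := Real.sqrt_pos.2 h
  refine ⟨?_, ?_⟩
  · rw [radialProj, lform_smul_left, lform_smul_right]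
    have := Real.mul_self_sqrt h.le
    field_simp
    linarith
  · exact mul_pos (inv_pos.2 h') hy.2

theorem radialProj_of_mem {x : Mink n} (hx : x ∈ Hyp n) : radialProj x = x := by
  rw [radialProj, hx.1]; simp

theorem contDiffOn_sqrt_neg_lform :
    ContDiffOn ℝ ∞ (fun y : Mink n => Real.sqrt (-lform y y)) (futureCone n) :=
  ((contDiffOn_id.lform contDiffOn_id).neg).sqrt fun y hy => (by linarith [hy.1] : 0 < -lform y y).ne'

theorem contDiffOn_radialProj : ContDiffOn ℝ ∞ (radialProj (n := n)) (futureCone n) :=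
  (contDiffOn_sqrt_neg_lform.inv fun y hy =>
    (Real.sqrt_pos.2 (by linarith [hy.1] : 0 < -lform y y)).ne').smul contDiffOn_id

end Hyperboloid

/-! ### Completeness of the leaves and their explicit form. -/

section Foliation

variable {n : ℕ} {V : Mink n → Mink n}

theorem IsGeodesicFoliation.lform_self (hV : IsGeodesicFoliation V) {x : Mink n} (hx : x ∈ Hyp n) :
    lform (V x) (V x) = 1 := by
  have h := hV.unit x hx
  rw [lnorm, Real.sqrt_eq_one] at h
  rwa [abs_of_nonneg (lform_self_nonneg_of_tangent hx (hV.tangent x hx))] at h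

/-- `x` and `V x` are orthogonal with squares `-1` and `1`, so `x ± V x` span the null lines of
their plane. These are the data from which the geodesic tangent to `V x` and its ends are computed.
-/
theorem IsGeodesicFoliation.null_ends (hV : IsGeodesicFoliation V) {x : Mink n} (hx : x ∈ Hyp n) :
    lform (x + V x) (x + V x) = 0 ∧ lform (x - V x) (x - V x) = 0 ∧
      lform (x + V x) (x - V x) = -2 ∧ 0 < (x + V x).1 ∧ 0 < (x - V x).1 := by
  have hsub : x - V x = x + (-1 : ℝ) • V x := by module
  have h0 := hx.1
  have h1 := hV.tangent x hx
  have h2 := hV.lform_self hx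
  have n1 : lform (x + V x) (x + V x) = 0 := by
    simp only [lform_add_left, lform_add_right, lform_comm (V x) x, h0, h1, h2]; norm_num
  have n2 : lform (x - V x) (x - V x) = 0 := by
    rw [hsub]
    simp only [lform_add_left, lform_add_right, lform_smul_left, lform_smul_right,
      lform_comm (V x) x, h0, h1, h2]; norm_num
  have n3 : lform (x + V x) (x - V x) = -2 := by
    rw [hsub]
    simp only [lform_add_left, lform_add_right, lform_smul_right,
      lform_comm (V x) x, h0, h1, h2]; norm_num
  have hp : 0 < (x + V x).1 + (x - V x).1 := by
    simp only [Prod.fst_add, Prod.fst_sub]; linarith [hx.2]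
  exact ⟨n1, n2, n3, fst_pos_of_null n1 n2 n3 hp,
    fst_pos_of_null n2 n1 (by rw [lform_comm]; exact n3) (by linarith)⟩

/-- `V ∘ radialProj` extends the restriction of `V` to an open cone, and its values there depend
only on `V` along `Hyp n`. -/
theorem IsGeodesicFoliation.contDiffOn_comp_radialProj (hV : IsGeodesicFoliation V) :
    ContDiffOn ℝ ∞ (fun y => V (radialProj y)) (futureCone n) := by
  obtain ⟨U, -, hU, hs⟩ := hV.smooth
  exact hs.comp contDiffOn_radialProj fun y hy => hU (radialProj_mem hy)

/-- Integral curves exist for short times, and they stay on the hyperboloid. -/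
theorem IsGeodesicFoliation.exists_integralCurve (hV : IsGeodesicFoliation V) {x : Mink n}
    (hx : x ∈ Hyp n) : ∃ (α : ℝ → Mink n) (ε : ℝ), 0 < ε ∧ α 0 = x ∧
      ∀ t ∈ Ioo (-ε) ε, α t ∈ Hyp n ∧ HasDerivAt α (V (α t)) t := by
  have hW : ContDiffAt ℝ 1 (fun y => V (radialProj y)) x :=
    (hV.contDiffOn_comp_radialProj.contDiffAt
      (isOpen_futureCone.mem_nhds (Hyp_subset_futureCone hx))).of_le (by simp)
  obtain ⟨α, h0, ε, hε, hα⟩ :=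
    hW.exists_forall_mem_closedBall_exists_eq_forall_mem_Ioo_hasDerivAt₀ 0
  have hc : ContinuousAt α 0 := (hα 0 ⟨by linarith, by linarith⟩).continuousAt
  have hev : ∀ᶠ t in 𝓝 (0 : ℝ), α t ∈ futureCone n :=
    hc (isOpen_futureCone.mem_nhds (by rw [h0]; exact Hyp_subset_futureCone hx))
  obtain ⟨δ, hδ, hcone⟩ := Metric.eventually_nhds_iff.1 hev
  have hsub : ∀ t ∈ Ioo (-min ε δ) (min ε δ), t ∈ Ioo (0 - ε) (0 + ε) ∧ α t ∈ futureCone n := by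
    intro t ht
    have h1 := min_le_left ε δ
    have h2 := min_le_right ε δ
    refine ⟨⟨by linarith [ht.1], by linarith [ht.2]⟩, hcone ?_⟩
    rw [Real.dist_eq, sub_zero, abs_lt]
    exact ⟨by linarith [ht.1], by linarith [ht.2]⟩
  -- The extended field at `y` is orthogonal to `radialProj y`, hence to `y`, so `⟨α, α⟩` is
  -- constant along the curve.
  have hder : ∀ t ∈ Ioo (-min ε δ) (min ε δ), HasDerivAt (fun t => lform (α t) (α t)) 0 t := by
    intro t ht
    obtain ⟨h1, h2⟩ := hsub t ht
    refine (hasDerivAt_lform (hα t h1) (hα t h1)).congr_deriv ?_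
    have h3 := hV.tangent _ (radialProj_mem h2)
    have h4 : 0 < (Real.sqrt (-lform (α t) (α t)))⁻¹ :=
      inv_pos.2 (Real.sqrt_pos.2 (by linarith [h2.1]))
    nth_rw 1 [radialProj] at h3
    rw [lform_smul_left] at h3
    have h5 := (mul_eq_zero.1 h3).resolve_left h4.ne'
    rw [lform_comm (V _), h5, add_zero]
  have hmin : 0 < min ε δ := lt_min hε hδ
  have h0mem : (0 : ℝ) ∈ Ioo (-min ε δ) (min ε δ) := ⟨by linarith, hmin⟩
  refine ⟨α, min ε δ, hmin, h0, fun t ht => ?_⟩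
  have hconst : lform (α t) (α t) = -1 := by
    rw [isOpen_Ioo.is_const_of_deriv_eq_zero isPreconnected_Ioo
      (fun t ht => (hder t ht).differentiableAt.differentiableWithinAt)
      (fun t ht => (hder t ht).deriv) ht h0mem, h0, hx.1]
  have hmem : α t ∈ Hyp n := ⟨hconst, (hsub t ht).2.2⟩
  have := hα t (hsub t ht).1
  rw [radialProj_of_mem hmem] at this
  exact ⟨hmem, this⟩

/-- Along an integral curve `⟨α, α'⟩ = 0` and `⟨α', α'⟩ = 1` give `⟨α, α''⟩ = -1`, so the geodesic
equation becomes `α'' = α`. Then `e⁻ᵗ (α + α')` and `eᵗ (α - α')` are constant, which determines `α`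
and its velocity. -/
theorem IsGeodesicFoliation.eventually_eq (hV : IsGeodesicFoliation V) {x : Mink n}
    (hx : x ∈ Hyp n) : ∀ᶠ t in 𝓝 (0 : ℝ),
      V ((Real.exp t / 2) • (x + V x) + (Real.exp (-t) / 2) • (x - V x)) =
        (Real.exp t / 2) • (x + V x) - (Real.exp (-t) / 2) • (x - V x) := by
  obtain ⟨α, ε, hε, h0, hα⟩ := hV.exists_integralCurve hx
  obtain ⟨hsm, hgeo⟩ := hV.geodesic α (-ε) ε hα
  have hev : ∀ t ∈ Ioo (-ε) ε, deriv α =ᶠ[𝓝 t] fun s => V (α s) := fun t ht =>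
    Filter.eventually_of_mem (isOpen_Ioo.mem_nhds ht) fun s hs => (hα s hs).2.deriv
  have hsm2 : ContDiffOn ℝ ∞ (deriv α) (Ioo (-ε) ε) :=
    ((contDiffOn_infty_iff_deriv_of_isOpen isOpen_Ioo).1 hsm).2
  have hd2 : ∀ t ∈ Ioo (-ε) ε, HasDerivAt (deriv α) (α t) t := by
    intro t ht
    have h1 : HasDerivAt (deriv α) (deriv (deriv α) t) t :=
      ((hsm2.differentiableOn (by simp)).differentiableAt (isOpen_Ioo.mem_nhds ht)).hasDerivAt
    have hd1 := (hα t ht).2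
    have h2 := hasDerivAt_lform hd1 h1
    have h3 : (fun s => lform (α s) (deriv α s)) =ᶠ[𝓝 t] fun _ => (0 : ℝ) := by
      filter_upwards [isOpen_Ioo.mem_nhds ht] with s hs
      rw [(hα s hs).2.deriv]
      exact hV.tangent _ (hα s hs).1
    have h4 := h2.unique ((hasDerivAt_const t (0 : ℝ)).congr_of_eventuallyEq h3)
    rw [hd1.deriv, hV.lform_self (hα t ht).1] at h4
    have h5 := (hgeo t ht).2
    rw [tanProj, (by linarith : lform (α t) (deriv (deriv α) t) = -1), neg_one_smul,
      ← sub_eq_add_neg, sub_eq_zero] at h5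
    rwa [h5] at h1
  have h0mem : (0 : ℝ) ∈ Ioo (-ε) ε := ⟨by linarith, hε⟩
  have hd0 : deriv α 0 = V x := by rw [(hα 0 h0mem).2.deriv, h0]
  have hU : ∀ t ∈ Ioo (-ε) ε, HasDerivAt (fun t => Real.exp (-t) • (α t + deriv α t)) 0 t :=
    fun t ht => by
      have h1 : HasDerivAt (fun t => Real.exp (-t)) (Real.exp (-t) * (-1)) t :=
        (hasDerivAt_neg t).exp
      refine (h1.smul ((hα t ht).2.add (hd2 t ht))).congr_deriv ?_
      simp only [Pi.add_apply]
      rw [(hα t ht).2.deriv]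
      module
  have hW : ∀ t ∈ Ioo (-ε) ε, HasDerivAt (fun t => Real.exp t • (α t - deriv α t)) 0 t :=
    fun t ht => by
      refine ((Real.hasDerivAt_exp t).smul ((hα t ht).2.sub (hd2 t ht))).congr_deriv ?_
      simp only [Pi.sub_apply]
      rw [(hα t ht).2.deriv]
      module
  filter_upwards [isOpen_Ioo.mem_nhds h0mem] with t ht
  have e1 := isOpen_Ioo.is_const_of_deriv_eq_zero isPreconnected_Ioo
    (fun t ht => (hU t ht).differentiableAt.differentiableWithinAt)
    (fun t ht => (hU t ht).deriv) ht h0mem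
  have e2 := isOpen_Ioo.is_const_of_deriv_eq_zero isPreconnected_Ioo
    (fun t ht => (hW t ht).differentiableAt.differentiableWithinAt)
    (fun t ht => (hW t ht).deriv) ht h0mem
  simp only [neg_zero, Real.exp_zero, one_smul, h0, hd0, (hα t ht).2.deriv] at e1 e2
  rw [← e1, ← e2, smul_smul, smul_smul]
  have h1 : Real.exp t / 2 * Real.exp (-t) = 1 / 2 := by
    rw [div_mul_eq_mul_div, ← Real.exp_add]; simp
  have h2 : Real.exp (-t) / 2 * Real.exp t = 1 / 2 := by
    rw [mul_comm, ← mul_div_assoc, ← Real.exp_add]; simp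
  rw [h1, h2]
  have h3 : (1 / 2 : ℝ) • (α t + V (α t)) + (1 / 2 : ℝ) • (α t - V (α t)) = α t := by module
  rw [h3]
  module

theorem hasDerivAt_exp_smul_add (u w : Mink n) (t : ℝ) :
    HasDerivAt (fun t : ℝ => (Real.exp t / 2) • u + (Real.exp (-t) / 2) • w)
      ((Real.exp t / 2) • u - (Real.exp (-t) / 2) • w) t := by
  have hexp : HasDerivAt (fun t => Real.exp (-t) / 2) (-(Real.exp (-t) / 2)) t := by
    refine ((hasDerivAt_neg t).exp.div_const 2).congr_deriv ?_
    ring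
  refine ((((Real.hasDerivAt_exp t).div_const 2).smul_const u).add
    (hexp.smul_const w)).congr_deriv ?_
  module

/-- Through each point of the hyperboloid there is a leaf, with the expected ends. -/
theorem IsGeodesicFoliation.exists_leaf (hV : IsGeodesicFoliation V) {x : Mink n}
    (hx : x ∈ Hyp n) : ∃ ℓ ∈ leafSet V,
      (gaussPlus ℓ : EuclideanSpace ℝ (Fin (n + 1))) = (x + V x).1⁻¹ • (x + V x).2 ∧
      (gaussMinus ℓ : EuclideanSpace ℝ (Fin (n + 1))) = (x - V x).1⁻¹ • (x - V x).2 := by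
  obtain ⟨hu, hw, huw, hu1, hw1⟩ := hV.null_ends hx
  set u := x + V x with hudef
  set w := x - V x with hwdef
  obtain ⟨γ, hγ⟩ := exists_geodesic hu hw huw hu1 hw1
  refine ⟨Quotient.mk _ γ, ⟨γ, rfl, ?_⟩, endPair_mk γ hu1 hw1 hγ⟩
  have hmem : ∀ t, γ.curve t ∈ Hyp n := fun t => (γ.geodesic.2 t (mem_univ t)).1
  have hγ' : γ.curve = fun t => (Real.exp t / 2) • u + (Real.exp (-t) / 2) • w := funext hγ
  have hd : ∀ t, HasDerivAt γ.curve ((Real.exp t / 2) • u - (Real.exp (-t) / 2) • w) t := by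
    rw [hγ']; exact hasDerivAt_exp_smul_add u w
  obtain ⟨U, -, hU, hs⟩ := hV.smooth
  -- The times at which the explicit geodesic follows `V` form a clopen set: closed by continuity,
  -- open by `eventually_eq` restarted at `t₁`, where `u` and `w` are rescaled by `e^{t₁}` and
  -- `e^{-t₁}`. Thus leaves are complete.
  let S : Set ℝ := {t | V (γ.curve t) = (Real.exp t / 2) • u - (Real.exp (-t) / 2) • w}
  have hcont : Continuous γ.curve := continuous_iff_continuousAt.2 fun t => (hd t).continuousAt
  have hclosed : IsClosed S :=
    isClosed_eq (hs.continuousOn.comp_continuous hcont fun t => hU (hmem t)) (by fun_prop)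
  have hopen : IsOpen S := by
    rw [isOpen_iff_mem_nhds]
    intro t₁ (ht₁ : V _ = _)
    have e1 : γ.curve t₁ + V (γ.curve t₁) = Real.exp t₁ • u := by rw [ht₁, hγ]; module
    have e2 : γ.curve t₁ - V (γ.curve t₁) = Real.exp (-t₁) • w := by rw [ht₁, hγ]; module
    have hev := hV.eventually_eq (hmem t₁)
    rw [e1, e2] at hev
    have htend : Tendsto (fun t => t - t₁) (𝓝 t₁) (𝓝 0) := by
      have : ContinuousAt (fun t => t - t₁) t₁ := by fun_prop
      simpa [ContinuousAt] using this
    filter_upwards [htend.eventually hev] with t ht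
    have h1 : Real.exp (t - t₁) / 2 * Real.exp t₁ = Real.exp t / 2 := by
      rw [div_mul_eq_mul_div, ← Real.exp_add]; simp
    have h2 : Real.exp (-(t - t₁)) / 2 * Real.exp (-t₁) = Real.exp (-t) / 2 := by
      rw [div_mul_eq_mul_div, ← Real.exp_add]; congr 2; ring
    rw [smul_smul, smul_smul, h1, h2] at ht
    change V (γ.curve t) = _
    rw [hγ, ht]
  have h0 : (0 : ℝ) ∈ S := by
    change V (γ.curve 0) = _
    have e : γ.curve 0 = x := by
      rw [hγ, hudef, hwdef]; simp only [neg_zero, Real.exp_zero]; module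
    rw [e, hudef, hwdef]; simp only [neg_zero, Real.exp_zero]; module
  have huniv : S = univ := IsClopen.eq_univ ⟨hclosed, hopen⟩ ⟨0, h0⟩
  intro t
  have ht : t ∈ S := huniv ▸ mem_univ t
  have : V (γ.curve t) = _ := ht
  rw [this]
  exact hd t

theorem exists_of_mem_leafSet {ℓ : OrientedGeodesic n} (hℓ : ℓ ∈ leafSet V) :
    ∃ u w : Mink n, lform u u = 0 ∧ lform w w = 0 ∧ lform u w = -2 ∧ 0 < u.1 ∧ 0 < w.1 ∧
      (gaussPlus ℓ : EuclideanSpace ℝ (Fin (n + 1))) = u.1⁻¹ • u.2 ∧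
      (gaussMinus ℓ : EuclideanSpace ℝ (Fin (n + 1))) = w.1⁻¹ • w.2 ∧
      ∀ t : ℝ, (Real.exp t / 2) • u + (Real.exp (-t) / 2) • w ∈ Hyp n ∧
        V ((Real.exp t / 2) • u + (Real.exp (-t) / 2) • w) =
          (Real.exp t / 2) • u - (Real.exp (-t) / 2) • w := by
  obtain ⟨γ, rfl, hγ⟩ := hℓ
  obtain ⟨u, w, hu, hw, huw, hu1, hw1, h⟩ := γ.exists_eq
  obtain ⟨hp, hm⟩ := endPair_mk γ hu1 hw1 h
  refine ⟨u, w, hu, hw, huw, hu1, hw1, hp, hm, fun t => ?_⟩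
  have hγ' : γ.curve = fun t => (Real.exp t / 2) • u + (Real.exp (-t) / 2) • w := funext h
  have h1 := hγ t
  have h2 : HasDerivAt γ.curve ((Real.exp t / 2) • u - (Real.exp (-t) / 2) • w) t := by
    rw [hγ']; exact hasDerivAt_exp_smul_add u w t
  rw [← h]
  exact ⟨(γ.geodesic.2 t (mem_univ t)).1, h1.unique h2⟩

end Foliation

/-! ### The inverse function theorem. -/

section InverseFunction

variable {E : Type*} [NormedAddCommGroup E] [NormedSpace ℝ E] [FiniteDimensional ℝ E]

/-- The inverse function theorem for smooth maps, with a smooth inverse on the whole target. -/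
theorem exists_openPartialHomeomorph_contDiffOn_symm {f : E → E} {Ω : Set E} {a : E}
    (hΩ : IsOpen Ω) (ha : a ∈ Ω) (hf : ContDiffOn ℝ ∞ f Ω)
    (hker : ∀ v, fderiv ℝ f a v = 0 → v = 0) :
    ∃ P : OpenPartialHomeomorph E E, a ∈ P.source ∧ P.source ⊆ Ω ∧ (∀ y, P y = f y) ∧
      ContDiffOn ℝ ∞ P.symm P.target := by
  have : CompleteSpace E := FiniteDimensional.complete ℝ E
  have hat : ∀ y ∈ Ω, ContDiffAt ℝ ∞ f y := fun y hy => hf.contDiffAt (hΩ.mem_nhds hy)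
  have hinj : Function.Injective (fderiv ℝ f a : E →ₗ[ℝ] E) :=
    (injective_iff_map_eq_zero _).2 hker
  let L : E ≃L[ℝ] E := (LinearEquiv.ofInjectiveEndo _ hinj).toContinuousLinearEquiv
  have hL : (L : E →L[ℝ] E) = fderiv ℝ f a := by ext v; rfl
  have hd : HasFDerivAt f (L : E →L[ℝ] E) a := by
    rw [hL]; exact ((hat a ha).differentiableAt (by simp)).hasFDerivAt
  let Q := (hat a ha).toOpenPartialHomeomorph f hd (by simp)
  -- Invertibility of the derivative is an open condition; on `T` it holds at every point, so the
  -- inverse is smooth on the whole image.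
  let T : Set E := Ω ∩ fderiv ℝ f ⁻¹' (range ((↑) : (E ≃L[ℝ] E) → E →L[ℝ] E))
  have hT : IsOpen T := ((hf.continuousOn_fderiv_of_isOpen hΩ (by simp))).isOpen_inter_preimage hΩ
    ContinuousLinearEquiv.isOpen
  have hsrc : (Q.restr T).source = Q.source ∩ T := by
    rw [OpenPartialHomeomorph.restr_source, hT.interior_eq]
  refine ⟨Q.restr T, ?_, ?_, fun y => rfl, ?_⟩
  · rw [hsrc]
    exact ⟨(hat a ha).mem_toOpenPartialHomeomorph_source hd (by simp), ha, L, hL⟩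
  · rw [hsrc]; exact fun y hy => hy.2.1
  · intro z hz
    have hy : (Q.restr T).symm z ∈ (Q.restr T).source := (Q.restr T).map_target hz
    rw [hsrc] at hy
    obtain ⟨L', hL'⟩ := hy.2.2
    refine ((Q.restr T).contDiffAt_symm hz (f₀' := L') ?_ (hat _ hy.2.1)).contDiffWithinAt
    rw [hL']
    exact ((hat _ hy.2.1).differentiableAt (by simp)).hasFDerivAt

end InverseFunction

/-! ### The end map on a transversal hypersurface. -/

section Transversal

variable {n : ℕ} {V : Mink n → Mink n}

/-- The null vector spanned by the forward (`s = 1`) or backward (`s = -1`) end of the leaf through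
the radial projection of `y`. -/
noncomputable def endVec (V : Mink n → Mink n) (s : ℝ) (y : Mink n) : Mink n :=
  radialProj y + s • V (radialProj y)

/-- A map whose restriction to the hypersurface `{y ∈ Hyp n | ⟨y, v₀⟩ = 0}` sends a point to the end
of the leaf through it. -/
noncomputable def transversalMap (V : Mink n → Mink n) (s : ℝ) (v₀ y : Mink n) : Mink n :=
  (lform y v₀, Real.sqrt (-lform y y) • ((endVec V s y).1⁻¹ • (endVec V s y).2))

theorem IsGeodesicFoliation.endVec_null (hV : IsGeodesicFoliation V) {s : ℝ} (hs : s = 1 ∨ s = -1)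
    {y : Mink n} (hy : y ∈ futureCone n) :
    lform (endVec V s y) (endVec V s y) = 0 ∧ 0 < (endVec V s y).1 := by
  obtain ⟨h1, h2, -, h3, h4⟩ := hV.null_ends (radialProj_mem hy)
  rcases hs with rfl | rfl
  · rw [endVec, one_smul]; exact ⟨h1, h3⟩
  · rw [endVec, neg_one_smul, ← sub_eq_add_neg]; exact ⟨h2, h4⟩

theorem IsGeodesicFoliation.contDiffOn_endVec (hV : IsGeodesicFoliation V) (s : ℝ) :
    ContDiffOn ℝ ∞ (endVec V s) (futureCone n) :=
  contDiffOn_radialProj.add ((contDiff_const_smul s).comp_contDiffOn hV.contDiffOn_comp_radialProj)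

theorem IsGeodesicFoliation.contDiffOn_inv_smul_endVec (hV : IsGeodesicFoliation V) {s : ℝ}
    (hs : s = 1 ∨ s = -1) :
    ContDiffOn ℝ ∞ (fun y => (endVec V s y).1⁻¹ • (endVec V s y).2) (futureCone n) :=
  ((hV.contDiffOn_endVec s).fst.inv fun _ hy => (hV.endVec_null hs hy).2.ne').smul
    (hV.contDiffOn_endVec s).snd

theorem IsGeodesicFoliation.contDiffOn_transversalMap (hV : IsGeodesicFoliation V) {s : ℝ}
    (hs : s = 1 ∨ s = -1) (v₀ : Mink n) :
    ContDiffOn ℝ ∞ (transversalMap V s v₀) (futureCone n) :=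
  (contDiffOn_id.lform contDiffOn_const).prodMk
    (contDiffOn_sqrt_neg_lform.smul (hV.contDiffOn_inv_smul_endVec hs))

/-- The end is a unit vector, so the norm of the second component recovers the radial coordinate
that `radialProj` discards. Source and target of `transversalMap` thereby have equal dimension, and
points of the hypersurface go to `{0} × Sⁿ`. -/
theorem IsGeodesicFoliation.norm_transversalMap_snd (hV : IsGeodesicFoliation V) {s : ℝ}
    (hs : s = 1 ∨ s = -1) (v₀ : Mink n) {y : Mink n} (hy : y ∈ futureCone n) :
    ‖(transversalMap V s v₀ y).2‖ = Real.sqrt (-lform y y) := by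
  obtain ⟨h1, h2⟩ := hV.endVec_null hs hy
  have := inv_smul_mem_sphere h1 h2
  rw [mem_sphere_zero_iff_norm] at this
  rw [transversalMap, norm_smul, this, mul_one, Real.norm_of_nonneg (Real.sqrt_nonneg _)]

theorem hasDerivAt_mink_fst {f : ℝ → Mink n} {f' : Mink n} {t : ℝ} (hf : HasDerivAt f f' t) :
    HasDerivAt (fun s => (f s).1) f'.1 t :=
  (hasFDerivAt_fst (p := f t)).comp_hasDerivAt t hf

theorem hasDerivAt_mink_snd {f : ℝ → Mink n} {f' : Mink n} {t : ℝ} (hf : HasDerivAt f f' t) :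
    HasDerivAt (fun s => (f s).2) f'.2 t :=
  (hasFDerivAt_snd (p := f t)).comp_hasDerivAt t hf

/-- The derivative of a curve in the hyperboloid obtained by projecting a line. -/
theorem hasDerivAt_radialProj_line {x v : Mink n} (hx : x ∈ Hyp n) (hv : lform x v = 0) :
    HasDerivAt (fun t : ℝ => Real.sqrt (-lform (x + t • v) (x + t • v))) 0 0 ∧
    HasDerivAt (fun t : ℝ => radialProj (x + t • v)) v 0 := by
  have hline : HasDerivAt (fun t : ℝ => x + t • v) v 0 := by
    simpa using ((hasDerivAt_id (0 : ℝ)).smul_const v).const_add x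
  have h1 : HasDerivAt (fun t : ℝ => -lform (x + t • v) (x + t • v)) 0 0 := by
    refine (hasDerivAt_lform hline hline).neg.congr_deriv ?_
    simp only [zero_smul, add_zero, lform_comm v x, hv, neg_zero]
  have hx1 : -lform (x + (0 : ℝ) • v) (x + (0 : ℝ) • v) = 1 := by
    rw [zero_smul, add_zero, hx.1, neg_neg]
  have h2 : HasDerivAt (fun t : ℝ => Real.sqrt (-lform (x + t • v) (x + t • v))) 0 0 := by
    refine (h1.sqrt (by rw [hx1]; norm_num)).congr_deriv ?_
    simp
  refine ⟨h2, ?_⟩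
  have h3 := (h2.inv (by rw [hx1]; norm_num)).smul hline
  refine h3.congr_deriv ?_
  rw [Pi.inv_apply, hx1, Real.sqrt_one, inv_one, one_smul, neg_zero, zero_div, zero_smul, add_zero]

/-- The only use of the inequality `|∇_v V| < |v|`. The first component and the norm of the second
force a kernel vector to be tangent to the transversal; being stationary at infinity then forces
`∇_v V = -s • v`. -/
theorem IsTERFoliation.fderiv_transversalMap_injective (hV : IsTERFoliation V) {s : ℝ}
    (hs : s = 1 ∨ s = -1) {x : Mink n} (hx : x ∈ Hyp n) {v : Mink n}
    (h : fderiv ℝ (transversalMap V s (V x)) x v = 0) : v = 0 := by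
  have hG := hV.toIsGeodesicFoliation
  have hxc := Hyp_subset_futureCone hx
  have hss : s * s = 1 := by rcases hs with rfl | rfl <;> norm_num
  have hline : HasDerivAt (fun t : ℝ => x + t • v) v 0 := by
    simpa using ((hasDerivAt_id (0 : ℝ)).smul_const v).const_add x
  have hx0 : x + (0 : ℝ) • v = x := by simp
  have hcone : ∀ᶠ t in 𝓝 (0 : ℝ), x + t • v ∈ futureCone n :=
    hline.continuousAt (isOpen_futureCone.mem_nhds (by rw [hx0]; exact hxc))
  have hΦ : HasDerivAt (fun t : ℝ => transversalMap V s (V x) (x + t • v)) 0 0 := by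
    have h1 : HasFDerivAt (transversalMap V s (V x)) (fderiv ℝ (transversalMap V s (V x)) x)
        (x + (0 : ℝ) • v) := by
      rw [hx0]
      exact (((hG.contDiffOn_transversalMap hs (V x)).contDiffAt
        (isOpen_futureCone.mem_nhds hxc)).differentiableAt (by simp)).hasFDerivAt
    have := h1.comp_hasDerivAt (0 : ℝ) hline
    rwa [h] at this
  have hΦ1 : HasDerivAt (fun t : ℝ => (transversalMap V s (V x) (x + t • v)).1) 0 0 :=
    hasDerivAt_mink_fst hΦ
  have hΦ2 : HasDerivAt (fun t : ℝ => (transversalMap V s (V x) (x + t • v)).2) 0 0 :=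
    hasDerivAt_mink_snd hΦ
  -- `v` is orthogonal to `V x`
  have hvV : lform v (V x) = 0 := by
    have h1 := hasDerivAt_lform hline (hasDerivAt_const (0 : ℝ) (V x))
    have h2 := h1.unique hΦ1
    rw [← h2, hx0]
    simp [lform]
  -- `v` is tangent to the hyperboloid
  have hxv : lform x v = 0 := by
    have h1 := (hasDerivAt_lform hline hline).neg
    have h2 : HasDerivAt (fun t : ℝ => ‖(transversalMap V s (V x) (x + t • v)).2‖ ^ 2) 0 0 := by
      refine hΦ2.norm_sq.congr_deriv ?_
      simp
    have h3 : (fun t : ℝ => -lform (x + t • v) (x + t • v)) =ᶠ[𝓝 0]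
        fun t : ℝ => ‖(transversalMap V s (V x) (x + t • v)).2‖ ^ 2 := by
      filter_upwards [hcone] with t ht
      rw [hG.norm_transversalMap_snd hs _ ht, Real.sq_sqrt (by linarith [ht.1])]
    have h4 := h1.unique (h2.congr_of_eventuallyEq h3)
    rw [hx0, lform_comm v x] at h4
    linarith
  obtain ⟨hρ, hν⟩ := hasDerivAt_radialProj_line hx hxv
  have hν0 : radialProj (x + (0 : ℝ) • v) = x := by rw [hx0, radialProj_of_mem hx]
  have hVd : HasFDerivAt V (fderiv ℝ V x) (radialProj (x + (0 : ℝ) • v)) := by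
    rw [hν0]
    obtain ⟨U, hU, hsub, hsm⟩ := hG.smooth
    exact ((hsm.contDiffAt (hU.mem_nhds (hsub hx))).differentiableAt (by simp)).hasFDerivAt
  have hVν : HasDerivAt (fun t : ℝ => V (radialProj (x + t • v))) (fderiv ℝ V x v) 0 :=
    hVd.comp_hasDerivAt (0 : ℝ) hν
  set D := fderiv ℝ V x v with hD
  have hDV : lform D (V x) = 0 := by
    have h1 := hasDerivAt_lform hVν hVν
    have h2 : (fun t : ℝ => lform (V (radialProj (x + t • v))) (V (radialProj (x + t • v))))
        =ᶠ[𝓝 0] fun _ => (1 : ℝ) := by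
      filter_upwards [hcone] with t ht
      exact hG.lform_self (radialProj_mem ht)
    have h3 := h1.unique ((hasDerivAt_const (0 : ℝ) (1 : ℝ)).congr_of_eventuallyEq h2)
    rw [hν0, lform_comm (V x) D] at h3
    linarith
  have hU : HasDerivAt (fun t : ℝ => endVec V s (x + t • v)) (v + s • D) 0 :=
    hν.add (hVν.const_smul s)
  have hU0 : endVec V s (x + (0 : ℝ) • v) = x + s • V x := by rw [endVec, hν0]
  have hUx : endVec V s x = x + s • V x := by rw [← hU0, hx0]
  have hpos : 0 < (x + s • V x).1 := by rw [← hUx]; exact (hG.endVec_null hs hxc).2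
  have hU1 : HasDerivAt (fun t : ℝ => (endVec V s (x + t • v)).1) (v + s • D).1 0 :=
    hasDerivAt_mink_fst hU
  have hU2 : HasDerivAt (fun t : ℝ => (endVec V s (x + t • v)).2) (v + s • D).2 0 :=
    hasDerivAt_mink_snd hU
  have hx1 : Real.sqrt (-lform (x + (0 : ℝ) • v) (x + (0 : ℝ) • v)) = 1 := by
    rw [hx0, hx.1]; simp
  have hΦ0 : (transversalMap V s (V x) (x + (0 : ℝ) • v)).2 =
      (x + s • V x).1⁻¹ • (x + s • V x).2 := by
    rw [transversalMap, hU0]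
    change Real.sqrt (-lform (x + (0 : ℝ) • v) (x + (0 : ℝ) • v)) • _ = _
    rw [hx1, one_smul]
  -- differentiate `U₁ • Φ₂ = ρ • U₂`
  have hsnd : (v + s • D).2 = ((v + s • D).1 * (x + s • V x).1⁻¹) • (x + s • V x).2 := by
    have h1 := hU1.smul hΦ2
    have h2 := hρ.smul hU2
    have h3 : (fun t : ℝ => (endVec V s (x + t • v)).1 •
          (transversalMap V s (V x) (x + t • v)).2) =ᶠ[𝓝 0]
        fun t : ℝ => Real.sqrt (-lform (x + t • v) (x + t • v)) • (endVec V s (x + t • v)).2 := by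
      filter_upwards [hcone] with t ht
      rw [transversalMap, smul_comm,
        smul_inv_smul₀ (hG.endVec_null hs ht).2.ne']
    have h4 := (h2.congr_of_eventuallyEq h3).unique h1
    rw [hx1, hΦ0, hU0, one_smul, zero_smul, add_zero, smul_zero, zero_add, smul_smul] at h4
    exact h4
  set c := (v + s • D).1 * (x + s • V x).1⁻¹ with hc
  have hvec : v + s • D = c • (x + s • V x) := by
    refine Prod.ext ?_ ?_
    · rw [Prod.smul_fst, smul_eq_mul, hc, mul_assoc, inv_mul_cancel₀ hpos.ne', mul_one]
    · rw [Prod.smul_snd, ← hsnd]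
  -- Pairing with `V x` kills `v`, `D` and `x`, leaving `0 = c * s`.
  have hc0 : c = 0 := by
    have h1 := congrArg (fun z => lform z (V x)) hvec
    simp only [lform_add_left, lform_smul_left, hvV, hDV, hG.tangent x hx, hG.lform_self hx] at h1
    rcases hs with rfl | rfl <;> linarith
  rw [hc0, zero_smul] at hvec
  have hDv : D = (-s) • v := by
    have h1 := congrArg (fun z => s • z) hvec
    simp only [smul_add, smul_smul, hss, one_smul, smul_zero] at h1
    rw [neg_smul]
    exact eq_neg_of_add_eq_zero_right h1
  by_contra hv0
  -- Since `D = -s • v` is already tangent, it equals `∇_v V`, and its length is that of `v`.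
  have hter := hV.ter x hx v hxv hv0
  rw [covDeriv, ← hD, hDv, tanProj, lform_smul_right, hxv, mul_zero, zero_smul, add_zero, lnorm,
    lnorm, lform_smul_left, lform_smul_right, ← mul_assoc, neg_mul_neg, hss, one_mul] at hter
  exact lt_irrefl _ hter

theorem IsTERFoliation.exists_transversalMap_inverse (hV : IsTERFoliation V) {s : ℝ}
    (hs : s = 1 ∨ s = -1) {x : Mink n} (hx : x ∈ Hyp n) {Ω : Set (Mink n)} (hΩ : IsOpen Ω)
    (hxΩ : x ∈ Ω) (hΩc : Ω ⊆ futureCone n) :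
    ∃ P : OpenPartialHomeomorph (Mink n) (Mink n), x ∈ P.source ∧ P.source ⊆ Ω ∧
      (∀ y, P y = transversalMap V s (V x) y) ∧ ContDiffOn ℝ ∞ P.symm P.target :=
  exists_openPartialHomeomorph_contDiffOn_symm hΩ hxΩ
    ((hV.toIsGeodesicFoliation.contDiffOn_transversalMap hs (V x)).mono hΩc)
    fun _ h => hV.fderiv_transversalMap_injective hs hx h

end Transversal

/-! ### Where an oriented geodesic crosses a hyperplane. -/

section FootPoint

variable {n : ℕ} {V : Mink n → Mink n}

theorem radialProj_smul {c : ℝ} (hc : 0 < c) (y : Mink n) : radialProj (c • y) = radialProj y := by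
  rw [radialProj, radialProj, lform_smul_left, lform_smul_right,
    show -(c * (c * lform y y)) = c ^ 2 * -lform y y by ring, Real.sqrt_mul (sq_nonneg c),
    Real.sqrt_sq hc.le, smul_smul, mul_inv, mul_assoc, mul_comm, mul_assoc, mul_inv_cancel₀ hc.ne',
    mul_one]

/-- The null vector of height `1` over a point of the sphere at infinity. -/
def nullLift (q : Sph n) : Mink n := (1, (q : EuclideanSpace ℝ (Fin (n + 1))))

/-- The combination of `u` and `w` that is orthogonal to `v₀`. -/
noncomputable def crossVec (v₀ u w : Mink n) : Mink n := lform u v₀ • w + (-lform w v₀) • u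

/-- The oriented geodesics crossing the hyperplane orthogonal to `v₀` in the positive direction. -/
def crossing (v₀ : Mink n) : Set (OrientedGeodesic n) :=
  {ℓ | 0 < lform (nullLift (gaussPlus ℓ)) v₀ ∧ 0 < -lform (nullLift (gaussMinus ℓ)) v₀}

/-- The point where an oriented geodesic meets the hyperplane orthogonal to `v₀`. -/
noncomputable def footPoint (v₀ : Mink n) (ℓ : OrientedGeodesic n) : Mink n :=
  radialProj (crossVec v₀ (nullLift (gaussPlus ℓ)) (nullLift (gaussMinus ℓ)))

theorem continuous_lform {X : Type*} [TopologicalSpace X] {f g : X → Mink n} (hf : Continuous f)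
    (hg : Continuous g) : Continuous fun x => lform (f x) (g x) :=
  (hf.snd.inner hg.snd).sub (hf.fst.mul hg.fst)

theorem continuous_nullLift_gaussPlus :
    Continuous fun ℓ : OrientedGeodesic n => nullLift (gaussPlus ℓ) :=
  continuous_const.prodMk (continuous_subtype_val.comp (contMDiff_gaussPlus n).continuous)

theorem continuous_nullLift_gaussMinus :
    Continuous fun ℓ : OrientedGeodesic n => nullLift (gaussMinus ℓ) :=
  continuous_const.prodMk (continuous_subtype_val.comp (contMDiff_gaussMinus n).continuous)

theorem isOpen_crossing (v₀ : Mink n) : IsOpen (crossing v₀) :=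
  (isOpen_lt continuous_const (continuous_lform continuous_nullLift_gaussPlus continuous_const)).inter
    (isOpen_lt continuous_const
      (continuous_lform continuous_nullLift_gaussMinus continuous_const).neg)

theorem lform_nullLift_self (q : Sph n) : lform (nullLift q) (nullLift q) = 0 := by
  simp [lform, nullLift]

theorem lform_nullLift_neg (ℓ : OrientedGeodesic n) :
    lform (nullLift (gaussPlus ℓ)) (nullLift (gaussMinus ℓ)) < 0 := by
  have hne : gaussMinus ℓ ≠ gaussPlus ℓ := by
    have : endPair ℓ ∈ range (endPair (n := n)) := mem_range_self ℓ
    rwa [range_endPair] at this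
  have h : inner ℝ (gaussPlus ℓ : EuclideanSpace ℝ (Fin (n + 1)))
      (gaussMinus ℓ : EuclideanSpace ℝ (Fin (n + 1))) < 1 :=
    (inner_lt_one_iff_real_of_norm_eq_one (by simp) (by simp)).2
      fun h => hne (Subtype.ext h.symm)
  simp only [lform, nullLift]
  linarith

/-- With `A = ⟨u, v₀⟩ > 0` and `B = -⟨w, v₀⟩ > 0` for the two lifts, `A • w + B • u` has square
`2AB⟨u, w⟩`, negative because the ends are distinct, and height `A + B`. -/
theorem crossVec_mem_futureCone {v₀ : Mink n} {ℓ : OrientedGeodesic n} (hℓ : ℓ ∈ crossing v₀) :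
    crossVec v₀ (nullLift (gaussPlus ℓ)) (nullLift (gaussMinus ℓ)) ∈ futureCone n := by
  obtain ⟨hA, hB⟩ := hℓ
  have hneg := lform_nullLift_neg ℓ
  constructor
  · simp only [crossVec, lform_add_left, lform_add_right, lform_smul_left, lform_smul_right,
      lform_nullLift_self, lform_comm (nullLift (gaussMinus ℓ)) (nullLift (gaussPlus ℓ))]
    nlinarith [mul_pos hA hB]
  · simp only [crossVec, Prod.fst_add, Prod.smul_fst, nullLift, smul_eq_mul, mul_one] at hA hB ⊢
    linarith

theorem continuousOn_footPoint (v₀ : Mink n) : ContinuousOn (footPoint v₀) (crossing v₀) := by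
  refine contDiffOn_radialProj.continuousOn.comp (Continuous.continuousOn ?_)
    fun ℓ hℓ => crossVec_mem_futureCone hℓ
  exact ((continuous_lform continuous_nullLift_gaussPlus continuous_const).smul
    continuous_nullLift_gaussMinus).add
    ((continuous_lform continuous_nullLift_gaussMinus continuous_const).neg.smul
      continuous_nullLift_gaussPlus)

theorem smul_nullLift {u : Mink n} (hu : 0 < u.1) {q : Sph n}
    (hq : (q : EuclideanSpace ℝ (Fin (n + 1))) = u.1⁻¹ • u.2) : u.1 • nullLift q = u := by
  refine Prod.ext ?_ ?_
  · simp [nullLift]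
  · simp only [nullLift, Prod.smul_snd, hq, smul_inv_smul₀ hu.ne']

/-- The crossing condition and the foot point in terms of arbitrary null vectors at the ends. -/
theorem crossing_iff_footPoint_eq {v₀ u w : Mink n} {ℓ : OrientedGeodesic n} (hu : 0 < u.1)
    (hw : 0 < w.1) (hp : (gaussPlus ℓ : EuclideanSpace ℝ (Fin (n + 1))) = u.1⁻¹ • u.2)
    (hm : (gaussMinus ℓ : EuclideanSpace ℝ (Fin (n + 1))) = w.1⁻¹ • w.2) :
    (ℓ ∈ crossing v₀ ↔ 0 < lform u v₀ ∧ 0 < -lform w v₀) ∧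
      footPoint v₀ ℓ = radialProj (crossVec v₀ u w) := by
  have e1 := smul_nullLift hu hp
  have e2 := smul_nullLift hw hm
  have l1 : lform u v₀ = u.1 * lform (nullLift (gaussPlus ℓ)) v₀ := by
    rw [← lform_smul_left, e1]
  have l2 : -lform w v₀ = w.1 * -lform (nullLift (gaussMinus ℓ)) v₀ := by
    rw [mul_neg, ← lform_smul_left, e2]
  constructor
  · rw [l1, l2, mul_pos_iff_of_pos_left hu, mul_pos_iff_of_pos_left hw]; rfl
  · have : crossVec v₀ u w =
        (u.1 * w.1) • crossVec v₀ (nullLift (gaussPlus ℓ)) (nullLift (gaussMinus ℓ)) := by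
      have h : crossVec v₀ u w =
          (u.1 * lform (nullLift (gaussPlus ℓ)) v₀) • (w.1 • nullLift (gaussMinus ℓ)) +
          (w.1 * -lform (nullLift (gaussMinus ℓ)) v₀) • (u.1 • nullLift (gaussPlus ℓ)) := by
        rw [e1, e2, crossVec, l1, l2]
      rw [h, crossVec]
      module
    rw [this, radialProj_smul (mul_pos hu hw)]
    rfl

/-- The ends of the oriented geodesic `ℓ` are those of the leaf through `x`. -/
def HasEnds (V : Mink n → Mink n) (ℓ : OrientedGeodesic n) (x : Mink n) : Prop :=
  (gaussPlus ℓ : EuclideanSpace ℝ (Fin (n + 1))) = (x + V x).1⁻¹ • (x + V x).2 ∧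
    (gaussMinus ℓ : EuclideanSpace ℝ (Fin (n + 1))) = (x - V x).1⁻¹ • (x - V x).2

theorem HasEnds.eq {ℓ ℓ' : OrientedGeodesic n} {x : Mink n} (h : HasEnds V ℓ x)
    (h' : HasEnds V ℓ' x) : ℓ = ℓ' :=
  endPair_injective (Prod.ext (Subtype.ext (h.2.trans h'.2.symm))
    (Subtype.ext (h.1.trans h'.1.symm)))

/-- For `x` in the hyperplane, both coefficients in `crossVec` equal `⟨V x, v₀⟩`, so the sum is a
positive multiple of `x`. -/
theorem IsGeodesicFoliation.footPoint_of_hasEnds (hV : IsGeodesicFoliation V) {x v₀ : Mink n}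
    (hx : x ∈ Hyp n) (h0 : lform x v₀ = 0) (hpos : 0 < lform (V x) v₀) {ℓ : OrientedGeodesic n}
    (h : HasEnds V ℓ x) : ℓ ∈ crossing v₀ ∧ footPoint v₀ ℓ = x := by
  obtain ⟨-, -, -, hu, hw⟩ := hV.null_ends hx
  obtain ⟨h1, h2⟩ := crossing_iff_footPoint_eq (v₀ := v₀) hu hw h.1 h.2
  have l1 : lform (x + V x) v₀ = lform (V x) v₀ := by rw [lform_add_left, h0, zero_add]
  have l2 : lform (x - V x) v₀ = -lform (V x) v₀ := by
    rw [sub_eq_add_neg, ← neg_one_smul ℝ (V x), lform_add_left, lform_smul_left, h0]; ring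
  refine ⟨h1.2 ?_, ?_⟩
  · rw [l1, l2, neg_neg]; exact ⟨hpos, hpos⟩
  · have : crossVec v₀ (x + V x) (x - V x) = (2 * lform (V x) v₀) • x := by
      rw [crossVec, l1, l2]; module
    rw [h2, this, radialProj_smul (by linarith), radialProj_of_mem hx]

theorem hasEnds_of_mem_leafSet {ℓ : OrientedGeodesic n} (hℓ : ℓ ∈ leafSet V) :
    ∃ x ∈ Hyp n, HasEnds V ℓ x := by
  obtain ⟨u, w, -, -, -, -, -, hp, hm, h⟩ := exists_of_mem_leafSet hℓ
  obtain ⟨hx, hVx⟩ := h 0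
  refine ⟨_, hx, ?_, ?_⟩
  · rw [hVx, hp]
    simp only [neg_zero, Real.exp_zero]
    congr 3 <;> module
  · rw [hVx, hm]
    simp only [neg_zero, Real.exp_zero]
    congr 3 <;> module

theorem footPoint_of_mem_leafSet {v₀ : Mink n} {ℓ : OrientedGeodesic n} (hℓ : ℓ ∈ leafSet V)
    (hc : ℓ ∈ crossing v₀) :
    footPoint v₀ ℓ ∈ Hyp n ∧ lform (footPoint v₀ ℓ) v₀ = 0 ∧ HasEnds V ℓ (footPoint v₀ ℓ) := by
  obtain ⟨u, w, -, -, -, hu, hw, hp, hm, h⟩ := exists_of_mem_leafSet hℓ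
  obtain ⟨h1, h2⟩ := crossing_iff_footPoint_eq (v₀ := v₀) hu hw hp hm
  obtain ⟨hA, hB⟩ := h1.1 hc
  set A := lform u v₀ with hAdef
  set B := -lform w v₀ with hBdef
  -- The crossing time `log r` solves `⟨γ(t), v₀⟩ = (eᵗ A - e⁻ᵗ B) / 2 = 0`.
  set r := Real.sqrt (B / A) with hr
  have hr0 : 0 < r := Real.sqrt_pos.2 (div_pos hB hA)
  have hrr : A * r * r = B := by
    rw [mul_assoc, Real.mul_self_sqrt (div_pos hB hA).le]; field_simp
  have hinv : r * r⁻¹ = 1 := mul_inv_cancel₀ hr0.ne'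
  obtain ⟨hx, hVx⟩ := h (Real.log r)
  rw [Real.exp_neg, Real.exp_log hr0] at hx hVx
  set x := (r / 2) • u + (r⁻¹ / 2) • w with hxdef
  have hcross : crossVec v₀ u w = (2 * A * r) • x := by
    rw [crossVec, ← hAdef, ← hBdef, hxdef, smul_add, smul_smul, smul_smul,
      show 2 * A * r * (r / 2) = B by linarith,
      show 2 * A * r * (r⁻¹ / 2) = A by linear_combination A * hinv, add_comm]
  have hfoot : footPoint v₀ ℓ = x := by
    rw [h2, hcross, radialProj_smul (by positivity), radialProj_of_mem hx]
  rw [hfoot]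
  refine ⟨hx, ?_, ?_, ?_⟩
  · rw [hxdef, lform_add_left, lform_smul_left, lform_smul_left, ← hAdef,
      show lform w v₀ = -B by rw [hBdef, neg_neg], ← hrr]
    linear_combination (-A * r / 2) * hinv
  · have : x + V x = r • u := by rw [hVx, hxdef]; module
    rw [this, hp, Prod.smul_fst, Prod.smul_snd, smul_smul, smul_eq_mul, mul_inv_rev, mul_assoc,
      inv_mul_cancel₀ hr0.ne', mul_one]
  · have : x - V x = r⁻¹ • w := by rw [hVx, hxdef]; module
    rw [this, hm, Prod.smul_fst, Prod.smul_snd, smul_smul, smul_eq_mul, mul_inv_rev, mul_assoc,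
      inv_mul_cancel₀ (inv_pos.2 hr0).ne', mul_one]

end FootPoint

/-! ### The Gauss maps as local charts of `𝓜`. -/

section Charts

variable {n : ℕ} {V : Mink n → Mink n}

theorem HasEnds.coe_eq_endVec {ℓ : OrientedGeodesic n} {x : Mink n} (hx : x ∈ Hyp n)
    (h : HasEnds V ℓ x) {s : ℝ} {φ : OrientedGeodesic n → Sph n}
    (hφ : s = 1 ∧ φ = gaussPlus ∨ s = -1 ∧ φ = gaussMinus) :
    (φ ℓ : EuclideanSpace ℝ (Fin (n + 1))) = (endVec V s x).1⁻¹ • (endVec V s x).2 := by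
  rcases hφ with ⟨rfl, rfl⟩ | ⟨rfl, rfl⟩
  · rw [endVec, radialProj_of_mem hx, one_smul]; exact h.1
  · rw [endVec, radialProj_of_mem hx, neg_one_smul, ← sub_eq_add_neg]; exact h.2

/-- The inverse of the chart sends `q` to the leaf through `P.symm (0, q)`, a point of the
transversal. The sign `s` treats both Gauss maps at once. -/
theorem IsTERFoliation.exists_chart (hV : IsTERFoliation V) {s : ℝ}
    {φ : OrientedGeodesic n → Sph n} (hφ : s = 1 ∧ φ = gaussPlus ∨ s = -1 ∧ φ = gaussMinus)
    (ℓ₀ : leafSet V) : ∃ e : OpenPartialHomeomorph (leafSet V) (Sph n), ℓ₀ ∈ e.source ∧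
      (∀ ℓ ∈ e.source, e ℓ = φ ℓ) ∧ ContMDiffOn (𝓡 n) ((𝓡 n).prod (𝓡 n)) ∞
        (fun q => (e.symm q : OrientedGeodesic n)) e.target := by
  have hG := hV.toIsGeodesicFoliation
  have hs : s = 1 ∨ s = -1 := hφ.imp And.left And.left
  have hφc : Continuous φ := by
    rcases hφ with ⟨-, rfl⟩ | ⟨-, rfl⟩
    exacts [(contMDiff_gaussPlus n).continuous, (contMDiff_gaussMinus n).continuous]
  have hleaf : ∀ x : Mink n, ∃ ℓ : leafSet V, x ∈ Hyp n → HasEnds V ℓ x := by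
    intro x
    by_cases hx : x ∈ Hyp n
    · obtain ⟨ℓ, hℓ, h⟩ := hG.exists_leaf hx
      exact ⟨⟨ℓ, hℓ⟩, fun _ => h⟩
    · exact ⟨ℓ₀, fun h => absurd h hx⟩
  choose ψ hψ using hleaf
  obtain ⟨x₀, hx₀, hends₀⟩ := hasEnds_of_mem_leafSet ℓ₀.2
  set v₀ := V x₀ with hv₀
  have h1 : lform v₀ v₀ = 1 := hG.lform_self hx₀
  -- On `Ω` the leaves cross the hyperplane positively, so `footPoint` returns the base point.
  let Ω : Set (Mink n) := futureCone n ∩ (fun y => lform (V (radialProj y)) v₀) ⁻¹' Ioi 0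
  have hΩ : IsOpen Ω :=
    (hG.contDiffOn_comp_radialProj.lform contDiffOn_const).continuousOn.isOpen_inter_preimage
      isOpen_futureCone isOpen_Ioi
  have hxΩ : x₀ ∈ Ω := by
    refine ⟨Hyp_subset_futureCone hx₀, ?_⟩
    change 0 < lform (V (radialProj x₀)) v₀
    rw [radialProj_of_mem hx₀, ← hv₀, h1]; exact one_pos
  obtain ⟨P, hxP, hPΩ, hP, hPs⟩ :=
    hV.exists_transversalMap_inverse hs hx₀ hΩ hxΩ inter_subset_left
  let ι : Sph n → Mink n := fun q => (0, (q : EuclideanSpace ℝ (Fin (n + 1))))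
  have hιc : Continuous ι := continuous_const.prodMk continuous_subtype_val
  have hfwd : ∀ ℓ : leafSet V, (ℓ : OrientedGeodesic n) ∈ crossing v₀ →
      P (footPoint v₀ ℓ) = ι (φ ℓ) := by
    intro ℓ hℓ
    obtain ⟨hx, h0, he⟩ := footPoint_of_mem_leafSet ℓ.2 hℓ
    rw [hP, transversalMap, h0, hx.1, neg_neg, Real.sqrt_one, one_smul, ← he.coe_eq_endVec hx hφ]
  have hbwd : ∀ q, ι q ∈ P.target → P.symm (ι q) ∈ Hyp n ∧ lform (P.symm (ι q)) v₀ = 0 ∧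
      0 < lform (V (P.symm (ι q))) v₀ := by
    intro q hq
    set y := P.symm (ι q) with hy
    have hyΩ : y ∈ Ω := hPΩ (P.map_target hq)
    have hyq : transversalMap V s v₀ y = ι q := by rw [← hP, hy, P.right_inv hq]
    -- The second component of `ι q` is a unit vector, which puts `y` on the hyperboloid.
    have hsq : Real.sqrt (-lform y y) = 1 := by
      rw [← hG.norm_transversalMap_snd hs v₀ hyΩ.1, hyq]
      simp [ι]
    rw [Real.sqrt_eq_one] at hsq
    have hyH : y ∈ Hyp n := ⟨by linarith, hyΩ.1.2⟩
    refine ⟨hyH, congrArg Prod.fst hyq, ?_⟩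
    have : 0 < lform (V (radialProj y)) v₀ := hyΩ.2
    rwa [radialProj_of_mem hyH] at this
  have hsmooth : ContMDiffOn (𝓡 n) ((𝓡 n).prod (𝓡 n)) ∞
      (fun q => (ψ (P.symm (ι q)) : OrientedGeodesic n)) (ι ⁻¹' P.target) := by
    have hopen : IsOpen (ι ⁻¹' P.target) := P.open_target.preimage hιc
    intro q hq
    refine ContMDiffAt.contMDiffWithinAt (contMDiffAt_iff_endPair.2 ?_)
    have hy : P.symm (ι q) ∈ futureCone n := (hPΩ (P.map_target hq)).1
    have hPq : ContMDiffAt (𝓡 n) 𝓘(ℝ, Mink n) ∞ (fun q' => P.symm (ι q')) q := by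
      have hι : ContMDiffAt (𝓡 n) 𝓘(ℝ, Mink n) ∞ ι q := by
        have : Fact (Module.finrank ℝ (EuclideanSpace ℝ (Fin (n + 1))) = n + 1) :=
          ⟨finrank_euclideanSpace_fin⟩
        exact (contMDiff_const.prodMk_space contMDiff_coe_sphere) q
      exact ((hPs.contDiffAt (P.open_target.mem_nhds hq)).contMDiffAt).comp q hι
    -- Smoothness into `𝓛` needs both ends, whichever one was inverted; each is the smooth
    -- expression in `endVec` at the base point.
    have hends : ∀ (s' : ℝ) (φ' : OrientedGeodesic n → Sph n),
        (s' = 1 ∧ φ' = gaussPlus ∨ s' = -1 ∧ φ' = gaussMinus) →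
        ContMDiffAt (𝓡 n) (𝓡 n) ∞ (fun q' => φ' (ψ (P.symm (ι q')))) q := by
      intro s' φ' h'
      refine contMDiffAt_sphere_of_coe ?_
      have hN := ((hG.contDiffOn_inv_smul_endVec (h'.imp And.left And.left)).contDiffAt
        (isOpen_futureCone.mem_nhds hy)).contMDiffAt
      refine (ContMDiffAt.comp q hN hPq).congr_of_eventuallyEq ?_
      filter_upwards [hopen.mem_nhds hq] with q' hq'
      exact (hψ _ (hbwd q' hq').1).coe_eq_endVec (hbwd q' hq').1 h'
    exact (hends _ _ (.inr ⟨rfl, rfl⟩)).prodMk (hends _ _ (.inl ⟨rfl, rfl⟩))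
  let e : OpenPartialHomeomorph (leafSet V) (Sph n) :=
    { toFun := fun ℓ => φ ℓ
      invFun := fun q => ψ (P.symm (ι q))
      -- This set is the trace on `𝓜` of an open subset of `𝓛`, so the chart is one for the subspace
      -- topology.
      source := Subtype.val ⁻¹' (crossing v₀ ∩ footPoint v₀ ⁻¹' P.source)
      target := ι ⁻¹' P.target
      map_source' := by
        intro ℓ hℓ
        change ι (φ ℓ) ∈ P.target
        rw [← hfwd ℓ hℓ.1]
        exact P.map_source hℓ.2
      map_target' := by
        intro q hq
        obtain ⟨hy, h0, hpos⟩ := hbwd q hq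
        obtain ⟨hc, hf⟩ := hG.footPoint_of_hasEnds hy h0 hpos (hψ _ hy)
        refine ⟨hc, ?_⟩
        change footPoint v₀ _ ∈ P.source
        rw [hf]
        exact P.map_target hq
      left_inv' := by
        intro ℓ hℓ
        obtain ⟨hx, -, he⟩ := footPoint_of_mem_leafSet ℓ.2 hℓ.1
        have hy : P.symm (ι (φ ℓ)) = footPoint v₀ ℓ := by
          rw [← hfwd ℓ hℓ.1, P.left_inv hℓ.2]
        change ψ (P.symm (ι (φ ℓ))) = ℓ
        rw [hy]
        exact Subtype.ext ((hψ _ hx).eq he)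
      right_inv' := by
        intro q hq
        obtain ⟨hy, -, -⟩ := hbwd q hq
        have h := congrArg Prod.snd (P.right_inv hq)
        rw [hP, transversalMap, hy.1, neg_neg, Real.sqrt_one, one_smul] at h
        exact Subtype.ext (((hψ _ hy).coe_eq_endVec hy hφ).trans h)
      open_source := ((continuousOn_footPoint v₀).isOpen_inter_preimage (isOpen_crossing v₀)
        P.open_source).preimage continuous_subtype_val
      open_target := P.open_target.preimage hιc
      continuousOn_toFun := (hφc.comp continuous_subtype_val).continuousOn
      continuousOn_invFun := IsInducing.subtypeVal.continuousOn_iff.2 hsmooth.continuousOn }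
  refine ⟨e, ?_, fun _ _ => rfl, hsmooth⟩
  obtain ⟨hc, hf⟩ := hG.footPoint_of_hasEnds (v₀ := v₀) hx₀ (hG.tangent _ hx₀)
    (by rw [← hv₀, h1]; exact one_pos) hends₀
  refine ⟨hc, ?_⟩
  change footPoint v₀ _ ∈ P.source
  rw [hf]
  exact hxP

end Charts

theorem mainTheorem5 (n : ℕ) (V : Mink n → Mink n) (hV : IsTERFoliation V) :
    (∃ cs : ChartedSpace (EuclideanSpace ℝ (Fin n)) (leafSet V),
      IsSubmanifoldStructure n (leafSet V) cs) ∧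
    ∀ cs : ChartedSpace (EuclideanSpace ℝ (Fin n)) (leafSet V),
      IsSubmanifoldStructure n (leafSet V) cs →
        IsLocalDiffeomorph (𝓡 n) (𝓡 n) ∞ (fun ℓ : leafSet V => gaussPlus (ℓ : OrientedGeodesic n)) ∧
        IsLocalDiffeomorph (𝓡 n) (𝓡 n) ∞ (fun ℓ : leafSet V => gaussMinus (ℓ : OrientedGeodesic n)) := by
  have hplus := hV.exists_chart (.inl ⟨rfl, rfl⟩)
  have hminus := hV.exists_chart (.inr ⟨rfl, rfl⟩)
  refine ⟨exists_isSubmanifoldStructure hplus, fun cs hcs => ?_⟩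
  exact ⟨isLocalDiffeomorph_of_charts hcs.2.isImmersion (contMDiff_gaussPlus n) hplus,
    isLocalDiffeomorph_of_charts hcs.2.isImmersion (contMDiff_gaussMinus n) hminus⟩
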